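/- Call a point of $\mathbb{R}^d$ an integer point if all its coordinates are integers, and call the convex hull of a non-empty finite set of integer points an integer polytope. Let $X$ be a random point uniformly distributed in $[0,1]^d$, and for a bounded set $C\subset\mathbb{R}^d$ let $X_C=|(C+X)\cap\mathbb{Z}^d|$ be the number of integer points in the translate $C+X$. Write $nC=\{nx : x\in C\}$ and $-C=\{-x : x\in C\}$. **Theorem.** Let $d\ge 1$ and let $P$ be an integer polytope in $\mathbb{R}^d$. Then there are sets $P_1,P_2,\dots,P_d\subset\mathbb{R}^d$ with $P_1=P$, each of which is the union of a non-empty finite family of pairwise disjoint integer polytopes (all of them with non-empty interior if $P$ has non-empty interior), such that $P_k=-P_{d+1-k}$ for all $1\le k\le d$ when $d\ge 2$ (when $d=1$, $P_1=-P_1+z$ for some $z\in\mathbb{Z}$), and such that for every positive integer $n$ $$X_{nP}=\sum_{k=1}^{d}\binom{n-k+d}{d}X_{P_k}\quad\text{almost surely.}$$ Moreover, there is a constant $c$ such that $X_{P_1}+X_{P_2}+\dots+X_{P_d}=c$ almost surely. The sets $P_k$ and the constant $c$ depend only on $P$. -/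

import Mathlib

open MeasureTheory
open scoped Pointwise

/-- A point of `ℝ^d` all of whose coordinates are integers. -/
def IsIntegerPoint {d : ℕ} (x : Fin d → ℝ) : Prop :=
  ∃ z : Fin d → ℤ, ∀ i, x i = (z i : ℝ)

/-- An integer polytope in `ℝ^d`: the convex hull of a non-empty finite set of integer points. -/
def IsIntegerPolytope {d : ℕ} (P : Set (Fin d → ℝ)) : Prop :=
  ∃ S : Finset (Fin d → ℝ),
    S.Nonempty ∧ (∀ v ∈ S, IsIntegerPoint v) ∧ P = convexHull ℝ (S : Set (Fin d → ℝ))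

/-- An integer polytope that is a convex body, i.e. has non-empty interior. -/
def IsIntegerBody {d : ℕ} (P : Set (Fin d → ℝ)) : Prop :=
  IsIntegerPolytope P ∧ (interior P).Nonempty

/-- `Q` is the union of a non-empty finite family of pairwise disjoint sets with property `C`. -/
def IsDisjointUnionOf {d : ℕ} (C : Set (Fin d → ℝ) → Prop) (Q : Set (Fin d → ℝ)) : Prop :=
  ∃ F : Set (Set (Fin d → ℝ)),
    F.Finite ∧ F.Nonempty ∧ (∀ A ∈ F, C A) ∧ F.PairwiseDisjoint id ∧ Q = ⋃₀ F

/-- The number of integer points in the translate `C + x`. It is used for bounded sets `C` only,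
for which this number is finite. Evaluated at a random point `X` it is the random variable
`X_C`. -/
noncomputable def latticeCount {d : ℕ} (C : Set (Fin d → ℝ)) (x : Fin d → ℝ) : ℕ :=
  Set.ncard (((fun c => c + x) '' C) ∩ {y | IsIntegerPoint y})

/-! For a simplex with integer vertices `v i`, use homogeneous barycentric coordinates: a point at
height `t` is given by `l` in `ℝ^(d+1)` with coordinate sum `t`, and the `n`-th dilate is the part
`l ≥ 0` of height `n`. Splitting `l` into integer and fractional parts cuts the dilate, up to a null
set, into integer translates of the hypersimplices `H k` = `slice hv (Set.Icc 0 1) k`, `1 ≤ k ≤ d`.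
Each `H k` occurs once for every natural vector of sum `n - k`, which gives the binomial
coefficients (`ae_latticeCount_smul_simplex`). Stacked at their heights, the `H k` count the integer
points of a translate of the parallelepiped spanned by the `(v i, 1)`. That parallelepiped is a
fundamental domain of a sublattice, so the total is constant (`exists_ae_sum_latticeCount_slice`).

A general `P` is triangulated up to a null set without new vertices (`exists_ae_triangulation`), and
the formulas are summed. As `H 1` is the simplex and `H d` its reflection up to an integer
translation, the end members can be `P` and `-P`. For the middle members, exact symmetry is obtained
by cutting each `H k` along `l 0 + l 1 = 1`: the reflection `l ↦ 1 - l` takes the lower half of `H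
k` to the upper half of `H (d + 1 - k)`. The upper halves, moved apart by integer vectors not
depending on `k`, together with reflected upper halves, form disjoint unions with the required
symmetry (`exists_symmetric_unions`). The halves are still integer polytopes because both
constraints are sums over initial blocks of coordinates (`upperCube_inter_eq_convexHull`).

If `P` has empty interior, it is null and all counts vanish almost surely. -/

/-! ### Lattice point counts of translates, up to null sets. -/

/-- An integer vector seen in `ℝ^d`. -/
def intVec {d : ℕ} (z : Fin d → ℤ) : Fin d → ℝ := fun i => (z i : ℝ)

lemma intVec_injective {d : ℕ} : Function.Injective (intVec (d := d)) := by
  intro a b h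
  funext i
  have := congrFun h i
  simpa [intVec] using this

lemma intVec_add {d : ℕ} (a b : Fin d → ℤ) : intVec (a + b) = intVec a + intVec b := by
  funext i; simp [intVec]

lemma intVec_sub {d : ℕ} (a b : Fin d → ℤ) : intVec (a - b) = intVec a - intVec b := by
  funext i; simp [intVec]

lemma intVec_sum_smul {d : ℕ} {ι : Type*} (s : Finset ι) (m : ι → ℤ) (w : ι → Fin d → ℤ) :
    intVec (∑ i ∈ s, m i • w i) = ∑ i ∈ s, (m i : ℝ) • intVec (w i) := by
  funext j; simp [intVec, Finset.sum_apply]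

lemma isIntegerPoint_iff {d : ℕ} {x : Fin d → ℝ} :
    IsIntegerPoint x ↔ ∃ z : Fin d → ℤ, intVec z = x := by
  constructor
  · rintro ⟨z, hz⟩; exact ⟨z, by funext i; simp [intVec, hz i]⟩
  · rintro ⟨z, rfl⟩; exact ⟨z, fun i => rfl⟩

/-- The integer vectors counted by `latticeCount C x`. -/
def countSet {d : ℕ} (C : Set (Fin d → ℝ)) (x : Fin d → ℝ) : Set (Fin d → ℤ) :=
  {z | intVec z - x ∈ C}

lemma latticeCount_eq_ncard {d : ℕ} (C : Set (Fin d → ℝ)) (x : Fin d → ℝ) :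
    latticeCount C x = (countSet C x).ncard := by
  rw [latticeCount, ← Set.ncard_image_of_injective _ intVec_injective]
  congr 1
  ext y
  simp only [Set.mem_inter_iff, Set.mem_image, Set.mem_ofPred_eq, isIntegerPoint_iff, countSet]
  constructor
  · rintro ⟨⟨c, hc, rfl⟩, z, hz⟩
    exact ⟨z, by simpa [hz] using hc, hz⟩
  · rintro ⟨z, hz, rfl⟩
    exact ⟨⟨_, hz, by simp⟩, z, rfl⟩

lemma countSet_finite {d : ℕ} {C : Set (Fin d → ℝ)} (hC : Bornology.IsBounded C)
    (x : Fin d → ℝ) : (countSet C x).Finite := by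
  obtain ⟨R, hR⟩ := hC.exists_norm_le
  apply (Set.Finite.pi' (t := fun i : Fin d => Set.Icc (-⌈R + ‖x‖⌉) ⌈R + ‖x‖⌉)
    (fun i => Set.finite_Icc _ _)).subset
  intro z hz i
  have h1 : ‖intVec z‖ ≤ R + ‖x‖ := by
    have := norm_add_le (intVec z - x) x
    rw [sub_add_cancel] at this
    linarith [hR _ hz]
  have h2 := abs_le.1 ((Real.norm_eq_abs _).symm.le.trans ((norm_le_pi_norm (intVec z) i).trans h1))
  have h3 := Int.le_ceil (R + ‖x‖)
  simp only [intVec] at h2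
  constructor
  · have : (-⌈R + ‖x‖⌉ : ℝ) ≤ z i := by linarith [h2.1]
    exact_mod_cast this
  · have : (z i : ℝ) ≤ ⌈R + ‖x‖⌉ := by linarith [h2.2]
    exact_mod_cast this

lemma latticeCount_image_add_intVec {d : ℕ} (C : Set (Fin d → ℝ)) (w : Fin d → ℤ)
    (x : Fin d → ℝ) : latticeCount ((fun u => u + intVec w) '' C) x = latticeCount C x := by
  rw [latticeCount_eq_ncard, latticeCount_eq_ncard,
    ← Set.ncard_image_of_injective (countSet C x) (add_left_injective w)]
  congr 1
  ext z
  simp only [countSet, Set.mem_image, Set.mem_ofPred_eq]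
  constructor
  · rintro ⟨u, hu, he⟩
    refine ⟨z - w, ?_, by simp⟩
    rw [intVec_sub]
    convert hu using 1
    rw [sub_right_comm, ← he, add_sub_cancel_right]
  · rintro ⟨y, hy, rfl⟩
    refine ⟨_, hy, ?_⟩
    rw [intVec_add]; abel

/-- A property that holds almost everywhere holds, for almost all `x`, at all points of the
translate of `ℤ^d` by `-x`. -/
lemma ae_forall_intVec_sub {d : ℕ} {p : (Fin d → ℝ) → Prop} (h : ∀ᵐ u, p u) :
    ∀ᵐ x, ∀ z : Fin d → ℤ, p (intVec z - x) := by
  rw [ae_all_iff]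
  intro z
  exact (quasiMeasurePreserving_sub_left volume (intVec z)).ae h

lemma ncard_eq_sum_of_pairwise_disjoint {α ι : Type*} (F : Finset ι) (B : ι → Set α) (C : Set α)
    (hB : ∀ i ∈ F, (B i).Finite) (hC : ∀ a, a ∈ C ↔ ∃ i ∈ F, a ∈ B i)
    (hd : ∀ a, ∀ i ∈ F, ∀ j ∈ F, a ∈ B i → a ∈ B j → i = j) :
    C.ncard = ∑ i ∈ F, (B i).ncard := by
  classical
  have hf : ∀ i, ∃ s : Finset α, i ∈ F → (s : Set α) = B i := by
    intro i
    by_cases hi : i ∈ F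
    · exact ⟨(hB i hi).toFinset, fun _ => by simp⟩
    · exact ⟨∅, fun h => absurd h hi⟩
  choose s hs using hf
  have h2 : C = (F.biUnion s : Finset _) := by
    ext z
    simp only [hC z, Finset.coe_biUnion, Set.mem_iUnion, Finset.mem_coe, exists_prop]
    refine exists_congr fun i => and_congr_right fun hi => ?_
    rw [← hs i hi, Finset.mem_coe]
  rw [h2, Set.ncard_coe_finset, Finset.card_biUnion]
  · refine Finset.sum_congr rfl fun i hi => ?_
    rw [← hs i hi, Set.ncard_coe_finset]
  · intro i hi j hj hij
    rw [Function.onFun, Finset.disjoint_left]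
    intro z hz hz'
    rw [← Finset.mem_coe, hs i hi] at hz
    rw [← Finset.mem_coe, hs j hj] at hz'
    exact hij (hd z i hi j hj hz hz')

/-- If `C` is almost everywhere the disjoint union of the sets `A i`, then the counts add up. -/
lemma ae_latticeCount_eq_sum {d : ℕ} {ι : Type*} (F : Finset ι) (A : ι → Set (Fin d → ℝ))
    (C : Set (Fin d → ℝ)) (hA : ∀ i ∈ F, Bornology.IsBounded (A i))
    (h : ∀ᵐ u, (u ∈ C ↔ ∃ i ∈ F, u ∈ A i) ∧ ∀ i ∈ F, ∀ j ∈ F, u ∈ A i → u ∈ A j → i = j) :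
    ∀ᵐ x, latticeCount C x = ∑ i ∈ F, latticeCount (A i) x := by
  filter_upwards [ae_forall_intVec_sub h] with x hx
  simp only [latticeCount_eq_ncard]
  exact ncard_eq_sum_of_pairwise_disjoint F _ _ (fun i hi => countSet_finite (hA i hi) x)
    (fun z => (hx z).1) (fun z => (hx z).2)

lemma ae_latticeCount_eq_zero {d : ℕ} {C : Set (Fin d → ℝ)} (h : volume C = 0) :
    ∀ᵐ x, latticeCount C x = 0 := by
  have := ae_latticeCount_eq_sum (∅ : Finset ℕ) (fun _ => ∅) C (by simp)
    (by filter_upwards [measure_eq_zero_iff_ae_notMem.1 h] with u hu using by simp [hu])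
  simpa using this

/-! ### Regular triangulations from generic heights. -/

section Triangulation

variable {V : Type} [NormedAddCommGroup V] [NormedSpace ℝ V] {ι : Type*} [Fintype ι]

/-- The weights live on all of `ι`, so that weights supported on different subsets can be compared
and perturbed in one space. -/
lemma mem_convexHull_image_iff_exists_weights {p : ι → V} {B : Set ι} {u : V} :
    u ∈ convexHull ℝ (p '' B) ↔
      ∃ w : ι → ℝ, (∀ i, 0 ≤ w i) ∧ (∀ i, i ∉ B → w i = 0) ∧ ∑ i, w i = 1 ∧
        ∑ i, w i • p i = u := by
  classical
  constructor
  · intro hu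
    have hconv : Convex ℝ {u : V | ∃ w : ι → ℝ, (∀ i, 0 ≤ w i) ∧ (∀ i, i ∉ B → w i = 0) ∧
        ∑ i, w i = 1 ∧ ∑ i, w i • p i = u} := by
      rintro _ ⟨w, h1, h2, h3, rfl⟩ _ ⟨w', h1', h2', h3', rfl⟩ a b ha hb hab
      refine ⟨a • w + b • w', fun i => ?_, fun i hi => ?_, ?_, ?_⟩
      · have := h1 i; have := h1' i
        simp only [Pi.add_apply, Pi.smul_apply, smul_eq_mul]; positivity
      · simp [h2 i hi, h2' i hi]
      · simp [Finset.sum_add_distrib, ← Finset.mul_sum, h3, h3', hab]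
      · simp [Finset.sum_add_distrib, add_smul, mul_smul, ← Finset.smul_sum]
    refine convexHull_min ?_ hconv hu
    rintro _ ⟨i, hi, rfl⟩
    refine ⟨Pi.single i 1, fun j => ?_, fun j hj => ?_, by simp, ?_⟩
    · by_cases h : j = i
      · subst h; simp
      · simp [h]
    · rw [Pi.single_eq_of_ne]; rintro rfl; exact hj hi
    · simp [Pi.single_apply]
  · rintro ⟨w, h1, h2, h3, rfl⟩
    have hs : ∀ i ∈ Finset.univ, i ∉ Finset.univ.filter (· ∈ B) → w i = 0 := by
      intro i _ hi; exact h2 i (by simpa using hi)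
    have h3' : ∑ i ∈ Finset.univ.filter (· ∈ B), w i = 1 := by
      rw [← h3]; exact Finset.sum_subset (Finset.subset_univ _) hs
    have h4 : ∑ i, w i • p i = ∑ i ∈ Finset.univ.filter (· ∈ B), w i • p i := by
      symm
      refine Finset.sum_subset (Finset.subset_univ _) fun i hi hi' => ?_
      rw [hs i hi hi', zero_smul]
    rw [h4]
    refine (convex_convexHull ℝ _).sum_mem (fun i _ => h1 i) h3' fun i hi => ?_
    exact subset_convexHull ℝ _ ⟨i, by simpa using hi, rfl⟩

/-- The total weight is left free: weight 1 gives convex combinations, weight 0 gives affine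
dependences. -/
lemma sum_mul_affineMap_apply (ℓ : V →ᵃ[ℝ] ℝ) (w : ι → ℝ) (p : ι → V) :
    ∑ i, w i * ℓ (p i) = ℓ.linear (∑ i, w i • p i) + (∑ i, w i) * ℓ 0 := by
  have h : ∀ x, ℓ x = ℓ.linear x + ℓ 0 := fun x => congrFun ℓ.decomp x
  rw [map_sum, Finset.sum_mul, ← Finset.sum_add_distrib]
  refine Finset.sum_congr rfl fun i _ => ?_
  rw [h (p i), map_smul, smul_eq_mul]; ring

/-- Heights in general position: points whose heights lie on the graph of an affine function are
affinely independent. -/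
lemma exists_generic_heights (p : ι → V) :
    ∃ h : ι → ℝ, ∀ (B : Set ι) (ℓ : V →ᵃ[ℝ] ℝ), (∀ i ∈ B, ℓ (p i) = h i) →
      AffineIndependent ℝ (fun i : B => p i) := by
  classical
  have key : ∀ B : {B : Set ι // ¬ AffineIndependent ℝ (fun i : B => p i)},
      ∃ w : ι → ℝ, (∀ i, i ∉ B.1 → w i = 0) ∧ ∑ i, w i = 0 ∧ ∑ i, w i • p i = 0 ∧
        ∃ i, w i ≠ 0 := by
    rintro ⟨B, hB⟩
    rw [affineIndependent_iff] at hB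
    push Not at hB
    obtain ⟨s, w, h1, h2, e, he, hwe⟩ := hB
    have aux : ∀ (M : Type _) [AddCommGroup M] [Module ℝ M] (f : ι → M),
        ∑ i, (if h : ∃ hi : i ∈ B, (⟨i, hi⟩ : B) ∈ s then w ⟨i, h.1⟩ else 0) • f i
          = ∑ i ∈ s, w i • f i := by
      intro M _ _ f
      rw [← Finset.sum_subset (Finset.subset_univ (s.map (Function.Embedding.subtype _)))]
      · rw [Finset.sum_map]
        refine Finset.sum_congr rfl fun i hi => ?_
        rw [dif_pos ⟨i.2, by simpa using hi⟩]; rfl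
      · intro i _ hi
        rw [dif_neg, zero_smul]
        rintro ⟨h3, h4⟩
        exact hi (Finset.mem_map.2 ⟨⟨i, h3⟩, h4, rfl⟩)
    refine ⟨fun i => if h : ∃ hi : i ∈ B, (⟨i, hi⟩ : B) ∈ s then w ⟨i, h.1⟩ else 0,
      fun i hi => dif_neg fun h => hi h.1, ?_, ?_, e, ?_⟩
    · simpa [h1] using aux ℝ (fun _ => 1)
    · rw [aux V p, h2]
    · simpa [he] using hwe
  choose w hw0 hw1 hw2 hw3 using key
  -- Each dependent `B` carries an affine dependence, viewed as a nonzero functional of the heights.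
  -- Some `h` avoids the finitely many kernels; heights that are affine on `B` would lie in the
  -- kernel belonging to `B`.
  obtain ⟨h, hh⟩ := Module.Dual.exists_forall_ne_zero_of_forall_exists
    (fun B => (Fintype.linearCombination ℝ (w B) : (ι → ℝ) →ₗ[ℝ] ℝ)) (fun B => by
      obtain ⟨i, hi⟩ := hw3 B
      exact ⟨Pi.single i 1, by simpa [Fintype.linearCombination_apply_single] using hi⟩)
  refine ⟨h, fun B ℓ hℓ => ?_⟩
  by_contra hB
  apply hh ⟨B, hB⟩
  have h1 := sum_mul_affineMap_apply ℓ (w ⟨B, hB⟩) p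
  rw [hw1, hw2, map_zero, zero_mul, add_zero] at h1
  rw [Fintype.linearCombination_apply, ← h1]
  refine Finset.sum_congr rfl fun i _ => ?_
  by_cases hi : i ∈ B
  · rw [hℓ i hi, smul_eq_mul, mul_comm]
  · simp [hw0 ⟨B, hB⟩ i hi]

/-- A point that is not in the affine span of points `p i`, unless these span everything. -/
def AffinelyGeneric (p : ι → V) (u : V) : Prop :=
  ∀ A : Set ι, u ∈ affineSpan ℝ (p '' A) → affineSpan ℝ (p '' A) = ⊤

/-- The lower hull of the points `(p i, h i)` has a supporting affine function over each generic
point of the convex hull. -/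
lemma exists_supporting_affineMap (p : ι → V) (h : ι → ℝ) {u : V}
    (hu : u ∈ convexHull ℝ (Set.range p)) (hgen : AffinelyGeneric p u) :
    ∃ ℓ : V →ᵃ[ℝ] ℝ, (∀ i, ℓ (p i) ≤ h i) ∧ u ∈ convexHull ℝ (p '' {i | ℓ (p i) = h i}) := by
  classical
  -- a minimizing weight
  obtain ⟨w, hw0, hw1, hwu, hmin⟩ : ∃ w : ι → ℝ, (∀ i, 0 ≤ w i) ∧ ∑ i, w i = 1 ∧
      ∑ i, w i • p i = u ∧ ∀ w' : ι → ℝ, (∀ i, 0 ≤ w' i) → ∑ i, w' i = 1 →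
        ∑ i, w' i • p i = u → ∑ i, w i * h i ≤ ∑ i, w' i * h i := by
    have hcomp : IsCompact (stdSimplex ℝ ι ∩ {w : ι → ℝ | ∑ i, w i • p i = u}) :=
      (isCompact_stdSimplex ℝ ι).inter_right (isClosed_eq (by fun_prop) continuous_const)
    have hne : (stdSimplex ℝ ι ∩ {w : ι → ℝ | ∑ i, w i • p i = u}).Nonempty := by
      rw [← Set.image_univ] at hu
      obtain ⟨w, h1, -, h2, h3⟩ := mem_convexHull_image_iff_exists_weights.1 hu
      exact ⟨w, ⟨h1, h2⟩, h3⟩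
    obtain ⟨w, ⟨⟨h1, h2⟩, h3⟩, hmin⟩ := hcomp.exists_isMinOn hne
      (f := fun w : ι → ℝ => ∑ i, w i * h i) (by fun_prop)
    exact ⟨w, h1, h2, h3, fun w' h1' h2' h3' => hmin ⟨⟨h1', h2'⟩, h3'⟩⟩
  -- First-order optimality: a direction that is feasible for a short time cannot lower the height.
  have hpert : ∀ D : ι → ℝ, (∀ i, w i = 0 → 0 ≤ D i) → ∑ i, D i = 0 → ∑ i, D i • p i = 0 →
      0 ≤ ∑ i, D i * h i := by
    intro D hD h1 h2
    have hev : ∀ᶠ ε in nhdsWithin (0 : ℝ) (Set.Ioi 0), ∀ i, 0 ≤ w i + ε * D i := by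
      rw [Filter.eventually_all]
      intro i
      rcases (hw0 i).eq_or_lt with hi | hi
      · filter_upwards [self_mem_nhdsWithin] with ε hε
        have := hD i hi.symm
        rw [← hi]
        have : (0 : ℝ) < ε := hε
        positivity
      · have hc : Filter.Tendsto (fun ε : ℝ => w i + ε * D i) (nhds 0) (nhds (w i + 0 * D i)) :=
          Continuous.tendsto (by fun_prop) 0
        have := (hc.eventually (lt_mem_nhds (by simpa using hi : (0:ℝ) < w i + 0 * D i)))
        exact (this.filter_mono nhdsWithin_le_nhds).mono fun ε hε => hε.le
    obtain ⟨ε, hε, hε0⟩ := (hev.and self_mem_nhdsWithin).exists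
    have hε0 : (0 : ℝ) < ε := hε0
    have h3 := hmin (fun i => w i + ε * D i) hε
      (by simp [Finset.sum_add_distrib, ← Finset.mul_sum, h1, hw1])
      (by simp [Finset.sum_add_distrib, add_smul, mul_smul, ← Finset.smul_sum, h2, hwu])
    simp only [add_mul, Finset.sum_add_distrib, mul_assoc, ← Finset.mul_sum] at h3
    have h4 : 0 ≤ ε * ∑ i, D i * h i := by linarith
    exact nonneg_of_mul_nonneg_right h4 hε0
  set A : Set ι := {i | w i ≠ 0} with hA
  have huA : u ∈ convexHull ℝ (p '' A) :=
    mem_convexHull_image_iff_exists_weights.2 ⟨w, hw0, fun i hi => by simpa [hA] using hi, hw1, hwu⟩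
  have hspan := hgen A (convexHull_subset_affineSpan _ huA)
  obtain ⟨t, htA, ht1, ht2⟩ := exists_affineIndependent ℝ V (p '' A)
  rw [hspan] at ht1
  choose g hgA hgp using fun b : t => htA b.2
  have htfin : Finite t := ((Set.toFinite (p '' A)).subset htA).to_subtype
  have : Fintype t := Fintype.ofFinite t
  let b : AffineBasis t ℝ V := ⟨(↑), ht2, by simpa using ht1⟩
  -- The support of `w` spans by genericity, hence contains an affine basis; `ℓ` interpolates the
  -- heights on it.
  let ℓ : V →ᵃ[ℝ] ℝ := ∑ j : t, h (g j) • b.coord j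
  have hℓ : ∀ x, ℓ x = ∑ j : t, b.coord j x * h (g j) := by
    intro x
    have : ∀ s : Finset t, (∑ j ∈ s, h (g j) • b.coord j) x = ∑ j ∈ s, b.coord j x * h (g j) := by
      intro s
      induction s using Finset.induction_on with
      | empty => simp
      | insert a s ha ih => rw [Finset.sum_insert ha, Finset.sum_insert ha, ← ih]; simp [mul_comm]
    exact this _
  -- The exchange of `p i` against its expansion in the basis. Its height is `h i - ℓ (p i)`, and it
  -- is feasible since every `g j` has nonzero weight.
  let D : ι → ι → ℝ := fun i => Pi.single i 1 - ∑ j : t, b.coord j (p i) • Pi.single (g j) 1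
  have hDsum : ∀ (M : Type _) [AddCommGroup M] [Module ℝ M] (i : ι) (f : ι → M),
      ∑ k, D i k • f k = f i - ∑ j : t, b.coord j (p i) • f (g j) := by
    intro M _ _ i f
    have hL : ∀ x : ι → ℝ, ∑ k, x k • f k = Fintype.linearCombination ℝ f x := fun x => rfl
    rw [hL]
    simp only [D, map_sub, map_sum, map_smul, Fintype.linearCombination_apply_single, one_smul]
  have hD1 : ∀ i, ∑ k, D i k = 0 := by
    intro i
    have := hDsum ℝ i (fun _ => 1)
    simpa [b.sum_coord_apply_eq_one] using this
  have hD2 : ∀ i, ∑ k, D i k • p k = 0 := by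
    intro i
    rw [hDsum V i p, sub_eq_zero]
    conv_lhs => rw [← b.linear_combination_coord_eq_self (p i)]
    exact Finset.sum_congr rfl fun j _ => by rw [hgp]; rfl
  have hD3 : ∀ i, ∑ k, D i k * h k = h i - ℓ (p i) := by
    intro i
    rw [hℓ]
    exact hDsum ℝ i h
  have hD0 : ∀ i k, w k = 0 → D i k = (Pi.single i 1 : ι → ℝ) k := by
    intro i k hk
    have : ∀ j : t, (Pi.single (g j) 1 : ι → ℝ) k = 0 := by
      intro j
      rw [Pi.single_eq_of_ne]
      rintro rfl
      exact hgA j hk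
    simp [D, Finset.sum_apply, this]
  have hs0 : ∀ i k, 0 ≤ (Pi.single i 1 : ι → ℝ) k := by
    intro i k
    by_cases hk : k = i
    · subst hk; simp
    · simp [hk]
  have hle : ∀ i, ℓ (p i) ≤ h i := by
    intro i
    have := hpert (D i) (fun k hk => by rw [hD0 i k hk]; exact hs0 i k) (hD1 i) (hD2 i)
    rw [hD3] at this
    linarith
  refine ⟨ℓ, hle, convexHull_mono (Set.image_mono ?_) huA⟩
  intro i hi
  -- On the support of `w` the reversed exchange is feasible too, which forces equality.
  have := hpert (-D i) (fun k hk => ?_) (by simp [hD1]) (by simp [hD2])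
  · simp only [Pi.neg_apply, neg_mul, Finset.sum_neg_distrib, hD3] at this
    exact le_antisymm (hle i) (by linarith)
  · rw [Pi.neg_apply, hD0 i k hk, Pi.single_eq_of_ne]
    · simp
    · rintro rfl; exact hi hk

/-- Expressing `u` by the points tight for `ℓ'` gives `ℓ u ≤ ℓ' u`. Averaging `h - ℓ' ∘ p ≥ 0` with
the weights `w` of `u` on `B` gives `ℓ u - ℓ' u ≤ 0`, so `ℓ'` is tight on the support of `w`. This
support spans by genericity, and by affine independence it is all of `B`. -/
lemma tight_subset_of_mem_convexHull {p : ι → V} {h : ι → ℝ} {u : V}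
    (hgen : AffinelyGeneric p u) {ℓ ℓ' : V →ᵃ[ℝ] ℝ} (hℓ : ∀ i, ℓ (p i) ≤ h i)
    (hℓ' : ∀ i, ℓ' (p i) ≤ h i)
    (hind : AffineIndependent ℝ (fun i : {i | ℓ (p i) = h i} => p i))
    (hu : u ∈ convexHull ℝ (p '' {i | ℓ (p i) = h i}))
    (hu' : u ∈ convexHull ℝ (p '' {i | ℓ' (p i) = h i})) :
    {i | ℓ (p i) = h i} ⊆ {i | ℓ' (p i) = h i} := by
  set B : Set ι := {i | ℓ (p i) = h i} with hB
  obtain ⟨w, hw0, hwB, hw1, hwu⟩ := mem_convexHull_image_iff_exists_weights.1 hu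
  obtain ⟨w', hw0', hwB', hw1', hwu'⟩ := mem_convexHull_image_iff_exists_weights.1 hu'
  have hval : ∀ (m : V →ᵃ[ℝ] ℝ) (x : ι → ℝ), ∑ i, x i = 1 → ∑ i, x i • p i = u →
      ∑ i, x i * m (p i) = m u := by
    intro m x h1 h2
    rw [sum_mul_affineMap_apply, h1, h2, one_mul]
    exact (congrFun m.decomp u).symm
  have e1 : ∑ i, w i * h i = ℓ u := by
    rw [← hval ℓ w hw1 hwu]
    refine Finset.sum_congr rfl fun i _ => ?_
    by_cases hi : i ∈ B
    · rw [show ℓ (p i) = h i from hi]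
    · simp [hwB i hi]
  have e2 : ∑ i, w' i * h i = ℓ' u := by
    rw [← hval ℓ' w' hw1' hwu']
    refine Finset.sum_congr rfl fun i _ => ?_
    by_cases hi : ℓ' (p i) = h i
    · rw [hi]
    · simp [hwB' i hi]
  have e3 : ℓ u ≤ ℓ' u := by
    rw [← e2, ← hval ℓ w' hw1' hwu']
    exact Finset.sum_le_sum fun i _ => mul_le_mul_of_nonneg_left (hℓ i) (hw0' i)
  have e4 : ∑ i, w i * (h i - ℓ' (p i)) = 0 := by
    refine le_antisymm ?_ (Finset.sum_nonneg fun i _ => mul_nonneg (hw0 i) (sub_nonneg.2 (hℓ' i)))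
    simp only [mul_sub, Finset.sum_sub_distrib, e1, hval ℓ' w hw1 hwu]
    linarith
  rw [Finset.sum_eq_zero_iff_of_nonneg
    (fun i _ => mul_nonneg (hw0 i) (sub_nonneg.2 (hℓ' i)))] at e4
  have hA := hgen {i | w i ≠ 0} (convexHull_subset_affineSpan _
    (mem_convexHull_image_iff_exists_weights.2
      ⟨w, hw0, fun i hi => by simpa using hi, hw1, hwu⟩))
  intro i hi
  have hwi : w i ≠ 0 := by
    have h1 : p i ∈ affineSpan ℝ ((fun i : B => p i) '' {j | w j ≠ 0}) := by
      have : (fun i : B => p i) '' {j | w j ≠ 0} = p '' {i | w i ≠ 0} := by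
        ext x
        constructor
        · rintro ⟨j, hj, rfl⟩; exact ⟨j, hj, rfl⟩
        · rintro ⟨j, hj, rfl⟩
          exact ⟨⟨j, by by_contra hjB; exact hj (hwB j hjB)⟩, hj, rfl⟩
      rw [this, hA]; trivial
    exact (hind.mem_affineSpan_iff ⟨i, hi⟩ _).1 h1
  have := (mul_eq_zero.1 (e4 i (Finset.mem_univ i))).resolve_left hwi
  exact (sub_eq_zero.1 this).symm


lemma ae_affinelyGeneric [FiniteDimensional ℝ V] [MeasurableSpace V] [BorelSpace V]
    (μ : Measure V) [μ.IsAddHaarMeasure] (p : ι → V) : ∀ᵐ u ∂μ, AffinelyGeneric p u := by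
  unfold AffinelyGeneric
  rw [ae_all_iff]
  intro A
  by_cases h : affineSpan ℝ (p '' A) = ⊤
  · simp [h]
  · filter_upwards [measure_eq_zero_iff_ae_notMem.1 (Measure.addHaar_affineSubspace μ _ h)]
      with u hu hu'
    exact absurd hu' hu

/-- The convex hull of a finite set is almost everywhere the disjoint union of finitely many
simplices whose vertices belong to the set. -/
theorem exists_ae_triangulation [FiniteDimensional ℝ V] [MeasurableSpace V] [BorelSpace V]
    (μ : Measure V) [μ.IsAddHaarMeasure] {n : ℕ} (hn : Module.finrank ℝ V = n) (S : Finset V) :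
    ∃ (J : Type) (_ : Fintype J) (v : J → Fin (n + 1) → V),
      (∀ j, AffineIndependent ℝ (v j)) ∧ (∀ j i, v j i ∈ S) ∧
      ∀ᵐ u ∂μ, (u ∈ convexHull ℝ (S : Set V) ↔ ∃ j, u ∈ convexHull ℝ (Set.range (v j))) ∧
        ∀ j j', u ∈ convexHull ℝ (Set.range (v j)) → u ∈ convexHull ℝ (Set.range (v j')) →
          j = j' := by
  classical
  let p : S → V := (↑)
  obtain ⟨h, hh⟩ := exists_generic_heights p
  -- The cells are the projected full-dimensional facets of the lower hull; generic heights make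
  -- them simplices.
  let J := {B : Set S // ∃ ℓ : V →ᵃ[ℝ] ℝ, (∀ i, ℓ (p i) ≤ h i) ∧ B = {i | ℓ (p i) = h i} ∧
    affineSpan ℝ (p '' B) = ⊤}
  have hind : ∀ B : J, AffineIndependent ℝ (fun i : B.1 => p i) := by
    rintro ⟨B, ℓ, h1, rfl, h2⟩
    exact hh _ ℓ fun i hi => hi
  have hcard : ∀ B : J, Fintype.card B.1 = n + 1 := by
    intro B
    have h1 := (hind B).affineSpan_eq_top_iff_card_eq_finrank_add_one
    rw [hn] at h1
    rw [← h1, Set.range_comp' p, Subtype.range_coe]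
    exact B.2.choose_spec.2.2
  let e : ∀ B : J, B.1 ≃ Fin (n + 1) := fun B => Fintype.equivFinOfCardEq (hcard B)
  let v : J → Fin (n + 1) → V := fun B i => p ((e B).symm i)
  have hrange : ∀ B, Set.range (v B) = p '' B.1 := by
    intro B
    have : v B = (fun i : B.1 => p i) ∘ (e B).symm := rfl
    rw [this, Set.range_comp _ (e B).symm, (e B).symm.range_eq_univ, Set.image_univ,
      Set.range_comp' p, Subtype.range_coe]
  refine ⟨J, Fintype.ofFinite J, v, fun B => ?_, fun B i => ?_, ?_⟩
  · exact (hind B).comp_embedding (e B).symm.toEmbedding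
  · exact ((e B).symm i).1.2
  · filter_upwards [ae_affinelyGeneric μ p] with u hgen
    have hS : Set.range p = (S : Set V) := Subtype.range_coe
    refine ⟨⟨fun hu => ?_, ?_⟩, ?_⟩
    · rw [← hS] at hu
      obtain ⟨ℓ, hℓ, hul⟩ := exists_supporting_affineMap p h hu hgen
      refine ⟨⟨_, ℓ, hℓ, rfl, hgen _ (convexHull_subset_affineSpan _ hul)⟩, ?_⟩
      rw [hrange]; exact hul
    · rintro ⟨B, hB⟩
      rw [hrange] at hB
      refine convexHull_mono ?_ hB
      rw [← hS]; exact Set.image_subset_range _ _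
    · have key : ∀ B B' : J, u ∈ convexHull ℝ (p '' B.1) → u ∈ convexHull ℝ (p '' B'.1) →
          B.1 ⊆ B'.1 := by
        rintro ⟨_, ℓ, hℓ, rfl, _⟩ ⟨_, ℓ', hℓ', rfl, _⟩ hB hB'
        exact tight_subset_of_mem_convexHull hgen hℓ hℓ' (hh _ ℓ fun i hi => hi) hB hB'
      intro B B' hB hB'
      rw [hrange] at hB hB'
      exact Subtype.ext (Set.Subset.antisymm (key B B' hB hB') (key B' B hB' hB))

end Triangulation

/-! ### Integrality of the halved hypersimplices. -/

section Rounding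

lemma integrable_floor_add (a : ℝ) :
    Integrable (fun θ : ℝ => (⌊a + θ⌋ : ℝ)) (volume.restrict (Set.Ioc 0 1)) := by
  refine Integrable.of_bound (C := |a| + 2) ?_ ?_
  · exact (by fun_prop : Measurable fun θ : ℝ => (⌊a + θ⌋ : ℝ)).aestronglyMeasurable
  · filter_upwards [ae_restrict_mem measurableSet_Ioc] with θ hθ
    have h1 := Int.floor_le (a + θ)
    have h2 := Int.lt_floor_add_one (a + θ)
    have h3 := neg_abs_le a
    have h4 := le_abs_self a
    rw [Real.norm_eq_abs, abs_le]
    constructor <;> linarith [hθ.1, hθ.2]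

/-- The fractional part has period 1 and mean 1/2, which cancels the mean of `θ`. -/
lemma integral_floor_add (a : ℝ) : ∫ θ in Set.Ioc (0 : ℝ) 1, (⌊a + θ⌋ : ℝ) = a := by
  have hper : Function.Periodic (Int.fract : ℝ → ℝ) 1 := fun x => Int.fract_add_one x
  have h1 : ∫ θ in (0 : ℝ)..1, Int.fract (a + θ) = 1 / 2 := by
    rw [intervalIntegral.integral_comp_add_left (fun x => Int.fract x), add_zero,
      hper.intervalIntegral_add_eq a 0, zero_add]
    have : ∫ θ in (0 : ℝ)..1, Int.fract θ = ∫ θ in (0 : ℝ)..1, θ := by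
      rw [intervalIntegral.integral_of_le zero_le_one, intervalIntegral.integral_of_le zero_le_one,
        ← integral_Ico_eq_integral_Ioc, ← integral_Ico_eq_integral_Ioc]
      exact setIntegral_congr_fun measurableSet_Ico fun x hx => Int.fract_eq_self.2 hx
    rw [this]; simp
  rw [intervalIntegral.integral_of_le zero_le_one] at h1
  have h2 : ∀ θ : ℝ, Int.fract (a + θ) = (a + θ) - ⌊a + θ⌋ := fun θ => rfl
  simp only [h2] at h1
  have hi : Integrable (fun θ : ℝ => a + θ) (volume.restrict (Set.Ioc 0 1)) :=
    (Continuous.integrableOn_Ioc (by fun_prop))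
  rw [integral_sub hi (integrable_floor_add a)] at h1
  have h3 : ∫ θ in Set.Ioc (0 : ℝ) 1, (a + θ) = a + 1 / 2 := by
    rw [← intervalIntegral.integral_of_le zero_le_one,
      intervalIntegral.integral_add (by simp) (by simp)]
    simp
  linarith

/-- The vectors with coordinates `0` and `1`, coordinate sum `k` and a `1` among the first two
coordinates. -/
def roundedPoints (d k : ℕ) : Set (Fin (d + 1) → ℝ) :=
  {w | (∀ i, w i = 0 ∨ w i = 1) ∧ ∑ i, w i = k ∧ 1 ≤ w 0 + w 1}

lemma roundedPoints_finite (d k : ℕ) : (roundedPoints d k).Finite := by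
  apply (Set.Finite.pi' (t := fun _ : Fin (d + 1) => ({0, 1} : Set ℝ))
    (fun i => by simp)).subset
  intro w hw i
  simpa using hw.1 i

/-- The part of the unit cube on which the first two coordinates have sum at least `1`. -/
def upperCube (d : ℕ) : Set (Fin (d + 1) → ℝ) := {l | l ∈ Set.Icc 0 1 ∧ 1 ≤ l 0 + l 1}

lemma convex_upperCube_inter (d k : ℕ) :
    Convex ℝ {l : Fin (d + 1) → ℝ | l ∈ upperCube d ∧ ∑ i, l i = k} := by
  rintro x ⟨⟨hx1, hx2⟩, hx3⟩ y ⟨⟨hy1, hy2⟩, hy3⟩ a b ha hb hab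
  refine ⟨⟨convex_Icc 0 1 hx1 hy1 ha hb hab, ?_⟩, ?_⟩
  · simp only [Pi.add_apply, Pi.smul_apply, smul_eq_mul]
    nlinarith
  · simp only [Pi.add_apply, Pi.smul_apply, smul_eq_mul, Finset.sum_add_distrib, ← Finset.mul_sum,
      hx3, hy3, ← add_mul, hab, one_mul]

/-- Randomized rounding along the partial sums. -/
theorem upperCube_inter_eq_convexHull {d : ℕ} (hd : 1 ≤ d) (k : ℕ) :
    {l : Fin (d + 1) → ℝ | l ∈ upperCube d ∧ ∑ i, l i = k} = convexHull ℝ (roundedPoints d k) := by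
  apply Set.Subset.antisymm
  · rintro l ⟨⟨⟨hl0, hl1⟩, hl2⟩, hl3⟩
    let s : ℕ → ℝ := fun n => ∑ j : Fin (d + 1), if (j : ℕ) < n then l j else 0
    have hs : ∀ i : Fin (d + 1), s (i + 1) = s i + l i := by
      intro i
      have : l i = ∑ j : Fin (d + 1), if j = i then l j else 0 := by simp
      rw [this]
      simp only [s, ← Finset.sum_add_distrib]
      refine Finset.sum_congr rfl fun j _ => ?_
      rcases lt_trichotomy (j : ℕ) i with h | h | h
      · rw [if_pos (by omega), if_pos h, if_neg (by rintro rfl; omega), add_zero]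
      · rw [if_pos (by omega), if_neg (by omega), if_pos (Fin.ext h), zero_add]
      · rw [if_neg (by omega), if_neg (by omega), if_neg (by rintro rfl; omega), add_zero]
    have hs0 : s 0 = 0 := by simp [s]
    have hsd : s (d + 1) = k := by
      rw [← hl3]
      exact Finset.sum_congr rfl fun j _ => if_pos j.2
    have h1v : ((1 : Fin (d + 1)) : ℕ) = 1 := by
      rw [Fin.val_one', Nat.mod_eq_of_lt (by omega)]
    have hs2 : s 2 = l 0 + l 1 := by
      have e1 := hs 0
      have e2 := hs 1
      rw [h1v] at e2
      simp only [Fin.val_zero, zero_add, hs0] at e1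
      rw [show (2 : ℕ) = 1 + 1 from rfl, e2, e1]
    -- Rounding all partial sums with a common random shift `θ` has mean `l`, so `l` is an average
    -- of the points `f θ`. Entries of `l` in `[0, 1]` make the increments 0 or 1.
    let f : ℝ → Fin (d + 1) → ℝ := fun θ i => (⌊s (i + 1) + θ⌋ : ℝ) - ⌊s i + θ⌋
    have hfi : ∀ i, Integrable (fun θ => f θ i) (volume.restrict (Set.Ioc 0 1)) := fun i =>
      (integrable_floor_add _).sub (integrable_floor_add _)
    have hprob : IsProbabilityMeasure (volume.restrict (Set.Ioc (0 : ℝ) 1)) :=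
      ⟨by simp⟩
    have hint : ∫ θ in Set.Ioc (0 : ℝ) 1, f θ = l := by
      funext i
      rw [eval_integral hfi]
      simp only [f]
      rw [integral_sub (integrable_floor_add _) (integrable_floor_add _), integral_floor_add,
        integral_floor_add, hs]
      ring
    rw [← hint]
    refine (convex_convexHull ℝ _).integral_mem ((roundedPoints_finite d k).isClosed_convexHull ℝ)
      ?_ (Integrable.of_eval hfi)
    filter_upwards [ae_restrict_mem measurableSet_Ioc] with θ hθ
    have hθ0 := hθ.1
    refine subset_convexHull ℝ _ ⟨fun i => ?_, ?_, ?_⟩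
    · have h1 : ⌊s i + θ⌋ ≤ ⌊s (i + 1) + θ⌋ := by
        apply Int.floor_le_floor
        have : 0 ≤ l i := hl0 i
        rw [hs]; linarith
      have h2 : ⌊s (i + 1) + θ⌋ ≤ ⌊s i + θ⌋ + 1 := by
        rw [← Int.floor_add_one]
        apply Int.floor_le_floor
        have : l i ≤ 1 := hl1 i
        rw [hs]; linarith
      have h3 : ⌊s (i + 1) + θ⌋ = ⌊s i + θ⌋ ∨ ⌊s (i + 1) + θ⌋ = ⌊s i + θ⌋ + 1 := by omega
      rcases h3 with h3 | h3
      · left; simp only [f, h3]; ring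
      · right; simp only [f, h3]; push_cast; ring
    · simp only [f]
      rw [Fin.sum_univ_eq_sum_range (fun n => (⌊s (n + 1) + θ⌋ : ℝ) - ⌊s n + θ⌋) (d + 1),
        Finset.sum_range_sub (fun n => (⌊s n + θ⌋ : ℝ)), hs0, hsd]
      rw [add_comm (k : ℝ), Int.floor_add_natCast]
      simp
    -- Coordinates 0 and 1 form an initial block, so their sum telescopes and the bound `1 ≤ s 2`
    -- survives rounding.
    · have e : f θ 0 + f θ 1 = (⌊s 2 + θ⌋ : ℝ) - ⌊s 0 + θ⌋ := by
        simp only [f, h1v, Fin.val_zero]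
        norm_num
      rw [e]
      have h1 : ⌊s 0 + θ⌋ + 1 ≤ ⌊s 2 + θ⌋ := by
        rw [← Int.floor_add_one]
        apply Int.floor_le_floor
        rw [hs0, hs2]; linarith
      have h1 : (⌊s 0 + θ⌋ : ℝ) + 1 ≤ ⌊s 2 + θ⌋ := by exact_mod_cast h1
      linarith
  · refine convexHull_min ?_ (convex_upperCube_inter d k)
    rintro w ⟨h1, h2, h3⟩
    refine ⟨⟨⟨fun i => ?_, fun i => ?_⟩, h3⟩, h2⟩
    · rcases h1 i with h | h <;> simp [h]
    · rcases h1 i with h | h <;> simp [h]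

end Rounding

lemma isBounded_image_add_right {d : ℕ} {A : Set (Fin d → ℝ)} (hA : Bornology.IsBounded A)
    (c : Fin d → ℝ) : Bornology.IsBounded ((fun u => u + c) '' A) := by
  rw [← Set.add_singleton]
  exact hA.add Bornology.isBounded_singleton

/-! ### Homogeneous coordinates and slices. -/

section Simplex

variable {d : ℕ}

/-- The point and the total weight determined by weights on the points `v i`. -/
noncomputable def weightMap (v : Fin (d + 1) → Fin d → ℝ) :
    (Fin (d + 1) → ℝ) →ₗ[ℝ] (Fin d → ℝ) × ℝ :=
  (Fintype.linearCombination ℝ v).prod (Fintype.linearCombination ℝ fun _ => (1 : ℝ))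

lemma weightMap_apply (v : Fin (d + 1) → Fin d → ℝ) (l : Fin (d + 1) → ℝ) :
    weightMap v l = (∑ i, l i • v i, ∑ i, l i) := by
  simp [weightMap, Fintype.linearCombination_apply]

lemma weightMap_injective {v : Fin (d + 1) → Fin d → ℝ} (hv : AffineIndependent ℝ v) :
    Function.Injective (weightMap v) := by
  rw [injective_iff_map_eq_zero]
  intro l hl
  rw [weightMap_apply, Prod.mk_eq_zero] at hl
  funext i
  exact affineIndependent_iff.1 hv Finset.univ l hl.2 hl.1 i (Finset.mem_univ i)

/-- Homogeneous barycentric coordinates with respect to the vertices of a simplex. -/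
noncomputable def coords {v : Fin (d + 1) → Fin d → ℝ} (hv : AffineIndependent ℝ v) :
    ((Fin d → ℝ) × ℝ) ≃ₗ[ℝ] (Fin (d + 1) → ℝ) :=
  (LinearEquiv.ofInjectiveOfFinrankEq (weightMap v) (weightMap_injective hv) (by simp)).symm

variable {v : Fin (d + 1) → Fin d → ℝ} (hv : AffineIndependent ℝ v)

lemma coords_sum (l : Fin (d + 1) → ℝ) : coords hv (∑ i, l i • v i, ∑ i, l i) = l := by
  rw [← weightMap_apply, coords, LinearEquiv.symm_apply_eq]
  rfl

lemma weightMap_coords (q : (Fin d → ℝ) × ℝ) : weightMap v (coords hv q) = q :=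
  LinearEquiv.apply_symm_apply
    (LinearEquiv.ofInjectiveOfFinrankEq (weightMap v) (weightMap_injective hv) (by simp)) q

lemma sum_coords (u : Fin d → ℝ) (t : ℝ) : ∑ i, coords hv (u, t) i = t := by
  have := weightMap_coords hv (u, t)
  rw [weightMap_apply] at this
  exact congrArg Prod.snd this

lemma sum_coords_smul (u : Fin d → ℝ) (t : ℝ) : ∑ i, coords hv (u, t) i • v i = u := by
  have := weightMap_coords hv (u, t)
  rw [weightMap_apply] at this
  exact congrArg Prod.fst this

lemma coords_sub_sum (u : Fin d → ℝ) (t : ℝ) (l : Fin (d + 1) → ℝ) :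
    coords hv (u - ∑ i, l i • v i, t - ∑ i, l i) = coords hv (u, t) - l := by
  rw [← Prod.mk_sub_mk, map_sub, coords_sum]

lemma coords_sum_sub (u : Fin d → ℝ) (t : ℝ) (l : Fin (d + 1) → ℝ) :
    coords hv (∑ i, l i • v i - u, ∑ i, l i - t) = l - coords hv (u, t) := by
  rw [← Prod.mk_sub_mk, map_sub, coords_sum]

lemma coords_smul (a : ℝ) (u : Fin d → ℝ) (t : ℝ) :
    coords hv (a • u, a * t) = a • coords hv (u, t) := by
  rw [← map_smul]; rfl

lemma continuous_coords (t : ℝ) : Continuous fun u => coords hv (u, t) := by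
  have : Continuous (coords hv) := LinearMap.continuous_of_finiteDimensional (coords hv).toLinearMap
  fun_prop

/-- The points of the plane at height `t` whose coordinates belong to `K`. -/
def slice (K : Set (Fin (d + 1) → ℝ)) (t : ℝ) : Set (Fin d → ℝ) := {u | coords hv (u, t) ∈ K}

lemma mem_slice {K : Set (Fin (d + 1) → ℝ)} {t : ℝ} {u : Fin d → ℝ} :
    u ∈ slice hv K t ↔ coords hv (u, t) ∈ K := Iff.rfl

lemma slice_eq_image (K : Set (Fin (d + 1) → ℝ)) (t : ℝ) :
    slice hv K t = Fintype.linearCombination ℝ v '' {l | l ∈ K ∧ ∑ i, l i = t} := by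
  ext u
  constructor
  · intro hu
    exact ⟨coords hv (u, t), ⟨hu, sum_coords hv u t⟩, sum_coords_smul hv u t⟩
  · rintro ⟨l, ⟨hl, rfl⟩, rfl⟩
    rw [mem_slice, Fintype.linearCombination_apply, coords_sum]
    exact hl

lemma isBounded_image_Icc (v : Fin (d + 1) → Fin d → ℝ) :
    Bornology.IsBounded (Fintype.linearCombination ℝ v '' Set.Icc 0 1) := by
  have hc : Continuous (Fintype.linearCombination ℝ v) :=
    LinearMap.continuous_of_finiteDimensional _
  exact (isCompact_Icc.image hc).isBounded

lemma slice_subset_image {K : Set (Fin (d + 1) → ℝ)} (hK : K ⊆ Set.Icc 0 1) (t : ℝ) :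
    slice hv K t ⊆ Fintype.linearCombination ℝ v '' Set.Icc 0 1 := by
  rw [slice_eq_image]
  exact Set.image_mono fun l hl => hK hl.1

lemma isBounded_slice {K : Set (Fin (d + 1) → ℝ)} (hK : K ⊆ Set.Icc 0 1) (t : ℝ) :
    Bornology.IsBounded (slice hv K t) :=
  (isBounded_image_Icc v).subset (slice_subset_image hv hK t)

lemma convexHull_range_eq_slice : convexHull ℝ (Set.range v) = slice hv (Set.Ici 0) 1 := by
  ext u
  rw [← Set.image_univ, mem_convexHull_image_iff_exists_weights, slice_eq_image]
  constructor
  · rintro ⟨w, h0, -, h1, rfl⟩; exact ⟨w, ⟨h0, h1⟩, rfl⟩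
  · rintro ⟨w, ⟨h0, h1⟩, rfl⟩; exact ⟨w, h0, by simp, h1, rfl⟩

lemma convexHull_range_eq_slice_Icc :
    convexHull ℝ (Set.range v) = slice hv (Set.Icc 0 1) 1 := by
  rw [convexHull_range_eq_slice hv]
  ext u
  refine ⟨fun hu => ⟨hu, fun i => ?_⟩, fun hu => hu.1⟩
  have hu : ∀ i, 0 ≤ coords hv (u, 1) i := hu
  rw [Pi.one_apply]
  conv_rhs => rw [← sum_coords hv u 1]
  exact Finset.single_le_sum (fun j _ => hu j) (Finset.mem_univ i)

lemma smul_convexHull_range_eq_slice {n : ℝ} (hn : 0 < n) :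
    n • convexHull ℝ (Set.range v) = slice hv (Set.Ici 0) n := by
  ext u
  rw [Set.mem_smul_set_iff_inv_smul_mem₀ hn.ne', convexHull_range_eq_slice hv, mem_slice,
    mem_slice]
  have := coords_smul hv n⁻¹ u n
  rw [inv_mul_cancel₀ hn.ne'] at this
  rw [this]
  simp only [Set.mem_Ici, Pi.le_def, Pi.zero_apply, Pi.smul_apply, smul_eq_mul]
  exact forall_congr' fun i => by rw [mul_nonneg_iff_of_pos_left (inv_pos.2 hn)]

/-- The vector `y` is a direction inside the slice along which `f` varies, so the level set is a
proper affine subspace. -/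
lemma ae_apply_coords_ne (f : Module.Dual ℝ (Fin (d + 1) → ℝ)) {y : Fin (d + 1) → ℝ}
    (hy : ∑ i, y i = 0) (hfy : f y ≠ 0) (t c : ℝ) : ∀ᵐ u, f (coords hv (u, t)) ≠ c := by
  let φ : (Fin d → ℝ) →ₗ[ℝ] ℝ := f ∘ₗ (coords hv).toLinearMap ∘ₗ LinearMap.inl ℝ _ ℝ
  have hφ : ∀ u, f (coords hv (u, t)) = φ u + f (coords hv (0, t)) := by
    intro u
    simp only [φ, LinearMap.comp_apply, LinearMap.inl_apply, LinearEquiv.coe_coe]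
    rw [← map_add, ← map_add]; simp
  let s : AffineSubspace ℝ (Fin d → ℝ) :=
    (AffineSubspace.mk' (c - f (coords hv (0, t))) ⊥).comap φ.toAffineMap
  have hs : ∀ u, u ∈ s ↔ φ u = c - f (coords hv (0, t)) := by
    intro u
    simp [s, AffineSubspace.mem_comap, AffineSubspace.mem_mk', sub_eq_zero]
  have htop : s ≠ ⊤ := by
    intro h
    have h0 := (hs 0).1 (by rw [h]; trivial)
    have h1 := (hs (∑ i, y i • v i)).1 (by rw [h]; trivial)
    rw [map_zero] at h0
    rw [← h0] at h1
    apply hfy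
    have h2 := coords_sum hv y
    rw [hy] at h2
    rw [← h2]
    exact h1
  filter_upwards [measure_eq_zero_iff_ae_notMem.1 (Measure.addHaar_affineSubspace volume s htop)]
    with u hu hc
  apply hu
  rw [SetLike.mem_coe, hs]
  rw [hφ] at hc
  linarith

/-- A second coordinate is needed: for `d = 0` the only coordinate is the constant `t`. -/
lemma ae_coords_ne_int (hd : 1 ≤ d) (t : ℝ) :
    ∀ᵐ u, ∀ (i : Fin (d + 1)) (m : ℤ), coords hv (u, t) i ≠ m := by
  simp only [ae_all_iff]
  intro i m
  obtain ⟨j, hj⟩ : ∃ j : Fin (d + 1), j ≠ i := by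
    have : Nontrivial (Fin (d + 1)) := Fin.nontrivial_iff_two_le.2 (by omega)
    exact exists_ne i
  exact ae_apply_coords_ne hv (LinearMap.proj i) (y := Pi.single i 1 - Pi.single j 1) (by simp)
    (by simp [hj.symm]) t m

/-- The `d + 1` fractional parts lie strictly between 0 and 1, so their sum, an integer, is one of
`1, …, d`. -/
lemma sum_floor_coords_bounds {n : ℕ} {u : Fin d → ℝ}
    (hu : ∀ (i : Fin (d + 1)) (m : ℤ), coords hv (u, n) i ≠ m)
    (h0 : ∀ i, 0 ≤ coords hv (u, n) i) :
    n < d + 1 + ∑ i, ⌊coords hv (u, n) i⌋₊ ∧ ∑ i, ⌊coords hv (u, n) i⌋₊ < n := by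
  have hsum := sum_coords hv u n
  have h1 : ∀ i, (⌊coords hv (u, n) i⌋₊ : ℝ) < coords hv (u, n) i := fun i =>
    lt_of_le_of_ne (Nat.floor_le (h0 i)) fun h => hu i ⌊coords hv (u, n) i⌋₊ (by simpa using h.symm)
  have h2 : ∀ i, coords hv (u, n) i < ⌊coords hv (u, n) i⌋₊ + 1 := fun i => Nat.lt_floor_add_one _
  have h3 := Finset.sum_lt_sum_of_nonempty Finset.univ_nonempty (fun i _ => h1 i)
  have h4 := Finset.sum_lt_sum_of_nonempty Finset.univ_nonempty (fun i _ => h2 i)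
  rw [hsum] at h3 h4
  simp only [Finset.sum_add_distrib, Finset.sum_const, Finset.card_univ, Fintype.card_fin,
    nsmul_eq_mul, mul_one] at h4
  constructor
  · have : (n : ℝ) < ((d + 1 + ∑ i, ⌊coords hv (u, n) i⌋₊ : ℕ) : ℝ) := by
      push_cast at h4 ⊢; linarith
    exact_mod_cast this
  · exact_mod_cast h3

/-- Stars and bars; for `k > n` the binomial coefficient vanishes because its upper entry is below
`d`. -/
lemma card_finsuppAntidiag_univ_fin (k n : ℕ) (hk : k ∈ Finset.Icc 1 d) :
    (if k ≤ n then (Finset.univ : Finset (Fin (d + 1))).finsuppAntidiag (n - k) else ∅).card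
      = (n + d - k).choose d := by
  rw [Finset.mem_Icc] at hk
  split_ifs with h
  · rw [Finset.card_finsuppAntidiag_nat_eq_choose, Finset.card_univ, Fintype.card_fin,
      show d + 1 + (n - k) - 1 = d + (n - k) by omega, show n + d - k = d + (n - k) by omega]
    rw [Nat.choose_symm_add]
  · rw [Finset.card_empty, Nat.choose_eq_zero_of_lt (by omega)]

end Simplex

/-! ### Dilates of an integer simplex and the constant sum. -/

section IntegerSimplex

variable {d : ℕ} {w : Fin (d + 1) → Fin d → ℤ}
  (hv : AffineIndependent ℝ fun i => intVec (w i))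

lemma ae_latticeCount_smul_simplex (hd : 1 ≤ d) {n : ℕ} (hn : 1 ≤ n) :
    ∀ᵐ x, latticeCount ((n : ℝ) • convexHull ℝ (Set.range fun i => intVec (w i))) x =
      ∑ k ∈ Finset.Icc 1 d, (n + d - k).choose d * latticeCount (slice hv (Set.Icc 0 1) k) x := by
  let F : Finset (Σ _ : ℕ, (Fin (d + 1) →₀ ℕ)) := (Finset.Icc 1 d).sigma fun k =>
    if k ≤ n then (Finset.univ : Finset (Fin (d + 1))).finsuppAntidiag (n - k) else ∅
  have hF : ∀ q, q ∈ F ↔ (1 ≤ q.1 ∧ q.1 ≤ d) ∧ q.1 ≤ n ∧ ∑ i, q.2 i = n - q.1 := by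
    rintro ⟨k, m⟩
    simp only [F, Finset.mem_sigma, Finset.mem_Icc]
    split_ifs with h
    · simp [h]
    · simp [h]
  -- The cell of points with integer parts `q.2`: an integer translate of the hypersimplex at height
  -- `q.1`.
  let A : (Σ _ : ℕ, (Fin (d + 1) →₀ ℕ)) → Set (Fin d → ℝ) := fun q =>
    (fun u => u + intVec (∑ i, (q.2 i : ℤ) • w i)) '' slice hv (Set.Icc 0 1) q.1
  have hA : ∀ q ∈ F, ∀ u, u ∈ A q ↔
      ∀ i, (q.2 i : ℝ) ≤ coords hv (u, n) i ∧ coords hv (u, n) i ≤ q.2 i + 1 := by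
    intro q hq u
    obtain ⟨-, h1, h2⟩ := (hF q).1 hq
    have h3 : (q.1 : ℝ) = n - ∑ i, (q.2 i : ℝ) := by
      have : (q.1 : ℝ) + ((∑ i, q.2 i : ℕ) : ℝ) = n := by
        rw [h2]; norm_cast; omega
      push_cast at this; linarith
    have h4 : u ∈ A q ↔ u - intVec (∑ i, (q.2 i : ℤ) • w i) ∈ slice hv (Set.Icc 0 1) q.1 := by
      simp only [A, Set.mem_image]
      exact ⟨by rintro ⟨y, hy, rfl⟩; simpa using hy, fun h => ⟨_, h, by simp⟩⟩
    rw [h4, mem_slice, intVec_sum_smul, h3]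
    have := coords_sub_sum hv u n (fun i => (q.2 i : ℝ))
    simp only [Int.cast_natCast]
    rw [this]
    simp only [Set.mem_Icc, Pi.le_def, Pi.sub_apply, Pi.one_apply, sub_nonneg,
      ← forall_and]
    exact forall_congr' fun i => and_congr_right fun _ => by
      constructor <;> intro h <;> linarith
  have key := ae_latticeCount_eq_sum F A
    ((n : ℝ) • convexHull ℝ (Set.range fun i => intVec (w i))) (fun q _ => ?_) ?_
  · filter_upwards [key] with x hx
    rw [hx, Finset.sum_sigma]
    refine Finset.sum_congr rfl fun k hk => ?_
    simp only [A, latticeCount_image_add_intVec, Finset.sum_const, smul_eq_mul]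
    rw [card_finsuppAntidiag_univ_fin k n hk]
  · exact isBounded_image_add_right (isBounded_slice hv subset_rfl _) _
  · rw [smul_convexHull_range_eq_slice hv (by exact_mod_cast hn)]
    filter_upwards [ae_coords_ne_int hv hd n] with u hu
    -- Closed cells overlap only where some coordinate is an integer, which has been excluded.
    have hfl : ∀ q ∈ F, u ∈ A q → ∀ i, q.2 i = ⌊coords hv (u, n) i⌋₊ := by
      intro q hq hqu i
      obtain ⟨h1, h2⟩ := (hA q hq u).1 hqu i
      symm
      rw [Nat.floor_eq_iff (le_trans (Nat.cast_nonneg _) h1)]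
      refine ⟨h1, lt_of_le_of_ne h2 ?_⟩
      have := hu i (q.2 i + 1)
      exact_mod_cast this
    refine ⟨⟨fun h0 => ?_, ?_⟩, ?_⟩
    · have h0 : ∀ i, 0 ≤ coords hv (u, n) i := h0
      obtain ⟨h1, h2⟩ := sum_floor_coords_bounds hv hu h0
      let q : Σ _ : ℕ, (Fin (d + 1) →₀ ℕ) := ⟨n - ∑ i, ⌊coords hv (u, n) i⌋₊,
        Finsupp.equivFunOnFinite.symm fun i => ⌊coords hv (u, n) i⌋₊⟩
      have hq : q ∈ F := by
        rw [hF]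
        simp only [q, Finsupp.coe_equivFunOnFinite_symm]
        omega
      refine ⟨q, hq, (hA q hq u).2 fun i => ?_⟩
      simp only [q, Finsupp.coe_equivFunOnFinite_symm]
      exact ⟨Nat.floor_le (h0 i), (Nat.lt_floor_add_one _).le⟩
    · rintro ⟨q, hq, hqu⟩ i
      exact le_trans (Nat.cast_nonneg _) ((hA q hq u).1 hqu i).1
    · intro q hq q' hq' hqu hqu'
      have h2 : q.2 = q'.2 := by
        ext i; rw [hfl q hq hqu, hfl q' hq' hqu']
      have h1 : q.1 = q'.1 := by
        obtain ⟨-, h3, h4⟩ := (hF q).1 hq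
        obtain ⟨-, h5, h6⟩ := (hF q').1 hq'
        rw [h2] at h4
        omega
      exact Sigma.ext h1 (heq_of_eq h2)

/-- The integer points of the half-open parallelepiped spanned by the vectors `(w i, 1)`,
translated by `(x, 0)`. -/
def parallelepipedPoints (x : Fin d → ℝ) : Set ((Fin d → ℤ) × ℤ) :=
  {q | ∀ i, 0 ≤ coords hv (intVec q.1 - x, q.2) i ∧ coords hv (intVec q.1 - x, q.2) i < 1}

/-- Translation of `q` by the lattice spanned by the `(w i, 1)` into the parallelepiped at `x`. -/
noncomputable def reduceInto (x : Fin d → ℝ) (q : (Fin d → ℤ) × ℤ) : (Fin d → ℤ) × ℤ :=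
  (q.1 - ∑ i, ⌊coords hv (intVec q.1 - x, q.2) i⌋ • w i,
    q.2 - ∑ i, ⌊coords hv (intVec q.1 - x, q.2) i⌋)

lemma coords_sub_int_combination (x : Fin d → ℝ) (q : (Fin d → ℤ) × ℤ) (m : Fin (d + 1) → ℤ) :
    coords hv (intVec (q.1 - ∑ i, m i • w i) - x, ((q.2 - ∑ i, m i : ℤ) : ℝ)) =
      coords hv (intVec q.1 - x, q.2) - fun i => (m i : ℝ) := by
  rw [← coords_sub_sum, intVec_sub, intVec_sum_smul, sub_right_comm]
  push_cast
  rfl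

lemma reduceInto_mem (x : Fin d → ℝ) (q : (Fin d → ℤ) × ℤ) :
    reduceInto hv x q ∈ parallelepipedPoints hv x := by
  intro i
  simp only [reduceInto, coords_sub_int_combination]
  exact ⟨Int.fract_nonneg _, Int.fract_lt_one _⟩

/-- All floors of `q` at `x` are zero, so after reduction at `x'` the floors at `x` undo exactly
what was subtracted. -/
lemma reduceInto_reduceInto {x x' : Fin d → ℝ} {q : (Fin d → ℤ) × ℤ}
    (hq : q ∈ parallelepipedPoints hv x) : reduceInto hv x (reduceInto hv x' q) = q := by
  have h : ∀ i, ⌊coords hv (intVec (reduceInto hv x' q).1 - x, (reduceInto hv x' q).2) i⌋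
      = - ⌊coords hv (intVec q.1 - x', q.2) i⌋ := by
    intro i
    simp only [reduceInto, coords_sub_int_combination, Pi.sub_apply, Int.floor_sub_intCast]
    rw [Int.floor_eq_zero_iff.2 (hq i), zero_sub]
  rw [reduceInto]
  simp only [h, neg_smul, Finset.sum_neg_distrib]
  simp [reduceInto]

/-- Both parallelepipeds are fundamental domains of the lattice spanned by the `(w i, 1)`; reduction
modulo it is a bijection between their integer points. -/
lemma ncard_parallelepipedPoints_eq (x x' : Fin d → ℝ) :
    (parallelepipedPoints hv x).ncard = (parallelepipedPoints hv x').ncard := by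
  rw [← Nat.card_coe_set_eq, ← Nat.card_coe_set_eq]
  exact Nat.card_congr
    { toFun := fun q => ⟨reduceInto hv x' q, reduceInto_mem hv x' q⟩
      invFun := fun q => ⟨reduceInto hv x q, reduceInto_mem hv x q⟩
      left_inv := fun q => Subtype.ext (reduceInto_reduceInto hv q.2)
      right_inv := fun q => Subtype.ext (reduceInto_reduceInto hv q.2) }

/-- For almost all `x` no relevant coordinate is an integer, so closed and half-open cubes count
alike. All integer points of the parallelepiped then have heights strictly between 0 and `d + 1`,
and the slices sort them by height. -/
lemma exists_ae_sum_latticeCount_slice (hd : 1 ≤ d) :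
    ∃ c : ℕ, ∀ᵐ x, ∑ k ∈ Finset.Icc 1 d, latticeCount (slice hv (Set.Icc 0 1) k) x = c := by
  refine ⟨(parallelepipedPoints hv 0).ncard, ?_⟩
  have h1 : ∀ᵐ x, ∀ (k : ℤ) (z : Fin d → ℤ),
      ∀ (i : Fin (d + 1)) (m : ℤ), coords hv (intVec z - x, (k : ℝ)) i ≠ m := by
    rw [ae_all_iff]
    exact fun k => ae_forall_intVec_sub (ae_coords_ne_int hv hd k)
  filter_upwards [h1] with x hx
  rw [ncard_parallelepipedPoints_eq hv 0 x]
  symm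
  have hinj : ∀ k : ℕ, Function.Injective fun z : Fin d → ℤ => (z, (k : ℤ)) := fun k a b h =>
    congrArg Prod.fst h
  have hmem : ∀ (k : ℕ) (q : (Fin d → ℤ) × ℤ),
      q ∈ (fun z : Fin d → ℤ => (z, (k : ℤ))) '' countSet (slice hv (Set.Icc 0 1) k) x ↔
        q.2 = k ∧ q ∈ parallelepipedPoints hv x := by
    rintro k ⟨z, t⟩
    constructor
    · rintro ⟨z, hz, h⟩
      obtain ⟨rfl, rfl⟩ := Prod.mk.injEq .. ▸ h
      refine ⟨rfl, fun i => ⟨by simpa using hz.1 i, lt_of_le_of_ne (by simpa using hz.2 i) ?_⟩⟩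
      simpa using hx k z i 1
    · rintro ⟨rfl, h⟩
      refine ⟨z, ⟨fun i => by simpa using (h i).1, fun i => by simpa using (h i).2.le⟩, rfl⟩
  rw [ncard_eq_sum_of_pairwise_disjoint (Finset.Icc 1 d)
    (fun k : ℕ => (fun z : Fin d → ℤ => (z, (k : ℤ))) '' countSet (slice hv (Set.Icc 0 1) k) x)
    (parallelepipedPoints hv x)]
  · refine Finset.sum_congr rfl fun k _ => ?_
    rw [Set.ncard_image_of_injective _ (hinj k), latticeCount_eq_ncard]
  · exact fun k _ => (countSet_finite (isBounded_slice hv subset_rfl _) x).image _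
  · intro q
    simp only [hmem]
    refine ⟨fun hq => ?_, by rintro ⟨k, -, -, h⟩; exact h⟩
    have hs := sum_coords hv (intVec q.1 - x) q.2
    have h0 : (0 : ℝ) < q.2 := by
      rw [← hs]
      refine Finset.sum_pos (fun i _ => lt_of_le_of_ne (hq i).1 ?_) Finset.univ_nonempty
      simpa using (hx q.2 q.1 i 0).symm
    have h1 : (q.2 : ℝ) < d + 1 := by
      have := Finset.sum_lt_sum_of_nonempty (s := (Finset.univ : Finset (Fin (d + 1))))
        Finset.univ_nonempty (fun i _ => (hq i).2)
      rw [hs] at this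
      simpa using this
    have h0 : 0 < q.2 := by exact_mod_cast h0
    have h1 : q.2 < d + 1 := by exact_mod_cast h1
    exact ⟨q.2.toNat, by rw [Finset.mem_Icc]; omega, by omega, hq⟩
  · intro q k _ k' _ h h'
    rw [hmem] at h h'
    exact_mod_cast h.1.symm.trans h'.1

end IntegerSimplex

/-! ### Integer polytopes, disjoint translates and symmetric unions. -/

section IntegerPolytopes

variable {d : ℕ}

lemma IsIntegerPolytope.of_finite {T : Set (Fin d → ℝ)} (hT : T.Finite) (hne : T.Nonempty)
    (hint : ∀ v ∈ T, IsIntegerPoint v) : IsIntegerPolytope (convexHull ℝ T) :=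
  ⟨hT.toFinset, by simpa using hne, fun v hv => hint v (by simpa using hv), by simp⟩

lemma IsIntegerPolytope.isBounded {P : Set (Fin d → ℝ)} (hP : IsIntegerPolytope P) :
    Bornology.IsBounded P := by
  obtain ⟨S, -, -, rfl⟩ := hP
  exact (S.finite_toSet.isCompact_convexHull ℝ).isBounded

lemma IsIntegerPolytope.convex {P : Set (Fin d → ℝ)} (hP : IsIntegerPolytope P) :
    Convex ℝ P := by
  obtain ⟨S, -, -, rfl⟩ := hP
  exact convex_convexHull ℝ _

lemma IsIntegerPolytope.neg {P : Set (Fin d → ℝ)} (hP : IsIntegerPolytope P) :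
    IsIntegerPolytope (-P) := by
  obtain ⟨S, hne, hS, rfl⟩ := hP
  rw [← convexHull_neg]
  refine .of_finite S.finite_toSet.neg (by simpa using hne) fun v hv => ?_
  obtain ⟨z, hz⟩ := hS _ hv
  exact ⟨-z, fun i => by have := hz i; simp at this ⊢; linarith⟩

lemma IsIntegerPolytope.add_intVec {P : Set (Fin d → ℝ)} (hP : IsIntegerPolytope P)
    (z : Fin d → ℤ) : IsIntegerPolytope ((fun u => u + intVec z) '' P) := by
  obtain ⟨S, hne, hS, rfl⟩ := hP
  have h : (fun u : Fin d → ℝ => u + intVec z) =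
      (AffineEquiv.constVAdd ℝ (Fin d → ℝ) (intVec z)).toAffineMap := by
    funext u; simp [add_comm]
  rw [h, AffineMap.image_convexHull, ← h]
  refine .of_finite (S.finite_toSet.image _) (Set.Nonempty.image _ (by simpa using hne)) ?_
  rintro _ ⟨v, hv, rfl⟩
  obtain ⟨y, rfl⟩ := isIntegerPoint_iff.1 (hS v hv)
  exact isIntegerPoint_iff.2 ⟨y + z, intVec_add y z⟩

lemma IsIntegerBody.neg {P : Set (Fin d → ℝ)} (hP : IsIntegerBody P) : IsIntegerBody (-P) := by
  refine ⟨hP.1.neg, ?_⟩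
  have : interior (-P) = -interior P := ((Homeomorph.neg (Fin d → ℝ)).preimage_interior P).symm
  rw [this]
  simpa using hP.2

lemma IsIntegerBody.add_intVec {P : Set (Fin d → ℝ)} (hP : IsIntegerBody P) (z : Fin d → ℤ) :
    IsIntegerBody ((fun u => u + intVec z) '' P) := by
  refine ⟨hP.1.add_intVec z, ?_⟩
  have := (Homeomorph.addRight (intVec z)).image_interior P
  simp only [Homeomorph.coe_addRight] at this
  rw [← this]
  exact hP.2.image _

lemma IsDisjointUnionOf.of_self {C : Set (Fin d → ℝ) → Prop} {P : Set (Fin d → ℝ)} (hP : C P) :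
    IsDisjointUnionOf C P :=
  ⟨{P}, by simp, by simp, by simpa using hP, by simp, by simp⟩

lemma IsDisjointUnionOf.mono {C C' : Set (Fin d → ℝ) → Prop} (h : ∀ A, C A → C' A)
    {P : Set (Fin d → ℝ)} (hP : IsDisjointUnionOf C P) : IsDisjointUnionOf C' P := by
  obtain ⟨F, h1, h2, h3, h4, h5⟩ := hP
  exact ⟨F, h1, h2, fun A hA => h A (h3 A hA), h4, h5⟩

lemma IsDisjointUnionOf.iUnion {C : Set (Fin d → ℝ) → Prop} {ι : Type*} [Finite ι] [Nonempty ι]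
    {A : ι → Set (Fin d → ℝ)} (hA : ∀ i, C (A i)) (hd : ∀ i j, i ≠ j → Disjoint (A i) (A j)) :
    IsDisjointUnionOf C (⋃ i, A i) := by
  refine ⟨Set.range A, Set.finite_range A, Set.range_nonempty A, by simpa using hA, ?_,
    (Set.sUnion_range A).symm⟩
  rintro _ ⟨i, rfl⟩ _ ⟨j, rfl⟩ hij
  exact hd i j fun h => hij (by rw [h])

lemma latticeCount_neg_image_add (C : Set (Fin d → ℝ)) (z : Fin d → ℤ) (x : Fin d → ℝ) :
    latticeCount (-((fun u => u + intVec z) '' C)) x = latticeCount (-C) x := by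
  rw [← latticeCount_image_add_intVec (-C) (-z)]
  congr 1
  ext u
  have h : intVec (-z) = -intVec z := by funext i; simp [intVec]
  simp only [Set.mem_neg, Set.mem_image, h]
  constructor
  · rintro ⟨y, hy, h⟩; exact ⟨-y, by simpa using hy, by rw [← neg_add, h, neg_neg]⟩
  · rintro ⟨y, hy, rfl⟩; exact ⟨-y, hy, by abel⟩

/-- Bounded sets have integer translates which, together with their reflections in the origin, are
pairwise disjoint. -/
lemma exists_disjoint_translates (hd : 1 ≤ d) {J : Type*} [Finite J] (Z : J → Set (Fin d → ℝ))
    (hZ : ∀ j, Bornology.IsBounded (Z j)) :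
    ∃ z : J → Fin d → ℤ,
      (∀ i j, i ≠ j → Disjoint ((fun u => u + intVec (z i)) '' Z i)
        ((fun u => u + intVec (z j)) '' Z j)) ∧
      ∀ i j, Disjoint ((fun u => u + intVec (z i)) '' Z i)
        (-((fun u => u + intVec (z j)) '' Z j)) := by
  obtain ⟨n, ⟨e⟩⟩ := Finite.exists_equiv_fin J
  obtain ⟨R, hR⟩ := (Bornology.isBounded_iUnion.2 hZ).exists_norm_le
  obtain ⟨M, hM⟩ := exists_nat_gt (2 * R)
  let i₀ : Fin d := ⟨0, hd⟩
  -- Shifts differ by at least `M > 2 * R`, which separates the translates. The `+ 1` makes their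
  -- first coordinates positive, hence those of the reflections negative.
  let z : J → Fin d → ℤ := fun j _ => M * ((e j : ℕ) + 1)
  have hz : ∀ j, intVec (z j) i₀ = M * ((e j : ℕ) + 1) := fun j => by simp [intVec, z]
  have hb : ∀ j, ∀ u ∈ Z j, -R ≤ u i₀ ∧ u i₀ ≤ R := by
    intro j u hu
    rw [← abs_le, ← Real.norm_eq_abs]
    exact (norm_le_pi_norm u i₀).trans (hR u (Set.mem_iUnion.2 ⟨j, hu⟩))
  have hlt : ∀ i j, (e i : ℕ) < e j → Disjoint ((fun u => u + intVec (z i)) '' Z i)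
      ((fun u => u + intVec (z j)) '' Z j) := by
    intro i j hij
    rw [Set.disjoint_left]
    rintro _ ⟨u, hu, rfl⟩ ⟨y, hy, h⟩
    have h := congrFun h i₀
    simp only [Pi.add_apply, hz] at h
    have h1 : ((e i : ℕ) : ℝ) + 1 ≤ (e j : ℕ) := by exact_mod_cast hij
    have h2 : (M : ℝ) * (((e i : ℕ) : ℝ) + 1) ≤ M * (e j : ℕ) :=
      mul_le_mul_of_nonneg_left h1 (Nat.cast_nonneg _)
    have := (hb i u hu).2
    have := (hb j y hy).1
    linarith
  refine ⟨z, fun i j hij => ?_, fun i j => ?_⟩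
  · rcases lt_trichotomy (e i : ℕ) (e j) with h | h | h
    · exact hlt i j h
    · exact absurd (e.injective (Fin.ext h)) hij
    · exact (hlt j i h).symm
  · rw [Set.disjoint_left]
    rintro _ ⟨u, hu, rfl⟩ ⟨y, hy, h⟩
    have h := congrFun h i₀
    simp only [Pi.add_apply, Pi.neg_apply, hz] at h
    have h1 : (0 : ℝ) ≤ M * (e i : ℕ) := by positivity
    have h2 : (0 : ℝ) ≤ M * (e j : ℕ) := by positivity
    have := (hb i u hu).1
    have := (hb j y hy).1
    linarith

/-- Integer bodies `A j k` can be moved by integer translations and completed by reflected copies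
to sets `U k` which satisfy the symmetry `U k = -U (d + 1 - k)`. -/
lemma exists_symmetric_unions (hd : 1 ≤ d) {J : Type*} [Fintype J] [Nonempty J]
    (Z : J → Set (Fin d → ℝ)) (hZ : ∀ j, Bornology.IsBounded (Z j))
    (A : J → ℕ → Set (Fin d → ℝ)) (hAZ : ∀ j k, A j k ⊆ Z j)
    (hA : ∀ j, ∀ k, 2 ≤ k → k + 1 ≤ d → IsIntegerBody (A j k)) :
    ∃ U : ℕ → Set (Fin d → ℝ), ∀ k, 2 ≤ k → k + 1 ≤ d →
      IsDisjointUnionOf IsIntegerBody (U k) ∧ U k = -U (d + 1 - k) ∧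
      ∀ᵐ x, latticeCount (U k) x =
        ∑ j, (latticeCount (A j k) x + latticeCount (-A j (d + 1 - k)) x) := by
  obtain ⟨z, hz1, hz2⟩ := exists_disjoint_translates hd Z hZ
  let T : J → ℕ → Set (Fin d → ℝ) := fun j k => (fun u => u + intVec (z j)) '' A j k
  have hTZ : ∀ j k, T j k ⊆ (fun u => u + intVec (z j)) '' Z j := fun j k =>
    Set.image_mono (hAZ j k)
  -- The shifts do not depend on `k`, so negation exchanges the two kinds of pieces between `k` and
  -- `d + 1 - k`.
  let B : ℕ → J ⊕ J → Set (Fin d → ℝ) := fun k =>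
    Sum.elim (fun j => T j k) (fun j => -T j (d + 1 - k))
  have hB : ∀ k p q, p ≠ q → Disjoint (B k p) (B k q) := by
    rintro k (i | i) (j | j) hij
    · exact (hz1 i j (by rintro rfl; exact hij rfl)).mono (hTZ _ _) (hTZ _ _)
    · exact (hz2 i j).mono (hTZ _ _) (Set.neg_subset_neg.2 (hTZ _ _))
    · exact ((hz2 j i).mono (hTZ _ _) (Set.neg_subset_neg.2 (hTZ _ _))).symm
    · have := (hz1 i j (by rintro rfl; exact hij rfl)).mono (hTZ _ (d + 1 - k)) (hTZ _ (d + 1 - k))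
      exact this.preimage _
  have hU : ∀ k u, u ∈ (⋃ q, B k q) ↔ (∃ j, u ∈ T j k) ∨ ∃ j, -u ∈ T j (d + 1 - k) := by
    intro k u
    simp [B]
  refine ⟨fun k => ⋃ q, B k q, fun k hk hkd => ⟨?_, ?_, ?_⟩⟩
  · refine IsDisjointUnionOf.iUnion ?_ (hB k)
    rintro (j | j)
    · exact (hA j k hk hkd).add_intVec _
    · exact ((hA j (d + 1 - k) (by omega) (by omega)).add_intVec _).neg
  · ext u
    rw [Set.mem_neg, hU, hU, show d + 1 - (d + 1 - k) = k by omega, neg_neg]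
    exact or_comm
  · have hbd : ∀ q, Bornology.IsBounded (B k q) := by
      rintro (j | j)
      · exact isBounded_image_add_right ((hZ j).subset (hAZ j k)) _
      · exact (isBounded_image_add_right ((hZ j).subset (hAZ j _)) _).neg
    filter_upwards [ae_latticeCount_eq_sum Finset.univ (B k) (⋃ q, B k q) (fun q _ => hbd q)
      (Filter.Eventually.of_forall fun u => ⟨by simp, fun p _ q _ hp hq => by
        by_contra hpq
        exact Set.disjoint_left.1 (hB k p q hpq) hp hq⟩)] with x hx
    rw [hx, Fintype.sum_sum_type, Finset.sum_add_distrib]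
    simp only [B, T, Sum.elim_inl, Sum.elim_inr, latticeCount_image_add_intVec,
      latticeCount_neg_image_add]

end IntegerPolytopes

/-! ### Reflection and halving of hypersimplices. -/

section IntegerSimplex

variable {d : ℕ} {w : Fin (d + 1) → Fin d → ℤ}
  (hv : AffineIndependent ℝ fun i => intVec (w i))

/-- The sum of the vertices has all coordinates 1 at height `d + 1`, so reflecting and adding it
acts as `l ↦ 1 - l`. -/
lemma image_add_neg_slice (K : Set (Fin (d + 1) → ℝ)) (t : ℝ) :
    (fun u => u + intVec (∑ i, w i)) '' (-slice hv K t) = slice hv {l | 1 - l ∈ K} (d + 1 - t) := by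
  ext u
  have h1 : u ∈ (fun u => u + intVec (∑ i, w i)) '' (-slice hv K t) ↔
      intVec (∑ i, w i) - u ∈ slice hv K t := by
    constructor
    · rintro ⟨y, hy, rfl⟩; simpa using hy
    · intro h; exact ⟨u - intVec (∑ i, w i), by simpa using h, by simp⟩
  rw [h1]
  have h2 := coords_sum_sub hv u (d + 1 - t) 1
  have h3 : intVec (∑ i, w i) = ∑ i, intVec (w i) := by
    have := intVec_sum_smul Finset.univ (fun _ => 1) w
    simpa using this
  simp only [Pi.one_apply, one_smul, Finset.sum_const, Finset.card_univ, Fintype.card_fin,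
    nsmul_eq_mul, mul_one, Nat.cast_add, Nat.cast_one, sub_sub_cancel] at h2
  rw [h3, mem_slice, mem_slice, h2]
  rfl

lemma latticeCount_neg_slice (K : Set (Fin (d + 1) → ℝ)) (t : ℝ) (x : Fin d → ℝ) :
    latticeCount (-slice hv K t) x = latticeCount (slice hv {l | 1 - l ∈ K} (d + 1 - t)) x := by
  rw [← image_add_neg_slice, latticeCount_image_add_intVec]

lemma latticeCount_neg_simplex (x : Fin d → ℝ) :
    latticeCount (-convexHull ℝ (Set.range fun i => intVec (w i))) x =
      latticeCount (slice hv (Set.Icc 0 1) d) x := by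
  rw [convexHull_range_eq_slice_Icc hv, latticeCount_neg_slice, add_sub_cancel_right]
  congr 2
  ext l
  simp [Set.mem_Icc, and_comm]

lemma upperCube_subset (d : ℕ) : upperCube d ⊆ Set.Icc 0 1 := fun _ h => h.1

/-- The lower half `l 0 + l 1 ≤ 1` is, up to an integer translation, the reflected upper half of the
complementary height. -/
lemma ae_latticeCount_slice_eq_add (hd : 2 ≤ d) {k : ℕ} (hk : k ≤ d) :
    ∀ᵐ x, latticeCount (slice hv (Set.Icc 0 1) k) x =
      latticeCount (slice hv (upperCube d) k) x +
        latticeCount (-slice hv (upperCube d) ((d + 1 - k : ℕ) : ℝ)) x := by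
  have h01 : (0 : Fin (d + 1)) ≠ 1 := by
    intro h
    have := congrArg Fin.val h
    rw [Fin.val_one', Nat.mod_eq_of_lt (by omega)] at this
    simp at this
  have hl0 : Fin.last d ≠ 0 := by
    intro h
    have := congrArg Fin.val h
    simp at this
    omega
  have hl1 : Fin.last d ≠ 1 := by
    intro h
    have := congrArg Fin.val h
    rw [Fin.val_one', Nat.mod_eq_of_lt (by omega)] at this
    simp at this
    omega
  have hcast : (d : ℝ) + 1 - ((d + 1 - k : ℕ) : ℝ) = k := by
    rw [Nat.cast_sub (by omega)]; push_cast; ring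
  let L : Set (Fin (d + 1) → ℝ) := {l | 1 - l ∈ upperCube d}
  have hL : ∀ l, l ∈ L ↔ l ∈ Set.Icc 0 1 ∧ l 0 + l 1 ≤ 1 := by
    intro l
    simp only [L, upperCube, Set.mem_ofPred_eq, Set.mem_Icc, sub_nonneg, sub_le_self_iff,
      Pi.sub_apply, Pi.one_apply]
    constructor
    · rintro ⟨⟨h1, h2⟩, h3⟩; exact ⟨⟨h2, h1⟩, by linarith⟩
    · rintro ⟨⟨h1, h2⟩, h3⟩; exact ⟨⟨h2, h1⟩, by linarith⟩
  let π : Fin (d + 1) → Module.Dual ℝ (Fin (d + 1) → ℝ) := fun i => LinearMap.proj i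
  let f : Module.Dual ℝ (Fin (d + 1) → ℝ) := π 0 + π 1
  have hf : ∀ l, f l = l 0 + l 1 := fun _ => rfl
  -- As `d ≥ 2`, there is a third coordinate to compensate, so `l 0 + l 1` is not constant on the
  -- slice.
  have hne := ae_apply_coords_ne hv f (y := Pi.single 0 1 - Pi.single (Fin.last d) 1) (by simp)
    (by rw [hf]; simp [hl0.symm, hl1.symm, h01.symm]) k 1
  have key := ae_latticeCount_eq_sum Finset.univ
    (fun b : Bool => if b then slice hv (upperCube d) k else slice hv L k)
    (slice hv (Set.Icc 0 1) k) (fun b _ => ?_) ?_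
  · filter_upwards [key] with x hx
    rw [hx, latticeCount_neg_slice, hcast]
    simp [L]
  · rcases b with _ | _
    · exact isBounded_slice hv (fun l hl => ((hL l).1 hl).1) _
    · exact isBounded_slice hv (upperCube_subset d) _
  · filter_upwards [hne] with u hu
    have hu : coords hv (u, k) 0 + coords hv (u, k) 1 ≠ 1 := hu
    simp only [Finset.mem_univ, true_and, Bool.exists_bool, Bool.forall_bool, forall_const]
    simp only [Bool.false_eq_true, if_false, if_true, mem_slice, hL]
    simp only [upperCube, Set.mem_ofPred_eq]
    refine ⟨⟨fun h => ?_, ?_⟩, ?_⟩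
    · rcases le_total (coords hv (u, k) 0 + coords hv (u, k) 1) 1 with h' | h'
      · exact Or.inl ⟨h, h'⟩
      · exact Or.inr ⟨h, h'⟩
    · rintro (h | h) <;> exact h.1
    · refine ⟨⟨by simp, fun h h' => ?_⟩, fun h h' => ?_, by simp⟩
      · exact absurd (le_antisymm h.2 h'.2) hu
      · exact absurd (le_antisymm h'.2 h.2) hu

/-- At height 1 the constraint would force all other coordinates to vanish; this is why the end
members are treated separately. -/
lemma interior_slice_upperCube_nonempty {k : ℕ} (hk : 2 ≤ k) (hkd : k + 1 ≤ d) :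
    (interior (slice hv (upperCube d) k)).Nonempty := by
  let O : Set (Fin (d + 1) → ℝ) := {l | (∀ i, 0 < l i) ∧ (∀ i, l i < 1) ∧ 1 < l 0 + l 1}
  have hO : IsOpen O := by
    have e : O = (⋂ i, {l | 0 < l i}) ∩ ((⋂ i, {l | l i < 1}) ∩ {l | 1 < l 0 + l 1}) := by
      ext l; simp [O]
    rw [e]
    refine (isOpen_iInter_of_finite fun i => isOpen_lt continuous_const (by fun_prop)).inter
      ((isOpen_iInter_of_finite fun i => isOpen_lt (by fun_prop) continuous_const).inter
        (isOpen_lt continuous_const (by fun_prop)))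
  have hOs : slice hv O k ⊆ interior (slice hv (upperCube d) k) := by
    refine interior_maximal ?_ (hO.preimage (continuous_coords hv k))
    rintro u ⟨h1, h2, h3⟩
    exact ⟨⟨fun i => (h1 i).le, fun i => (h2 i).le⟩, h3.le⟩
  refine Set.Nonempty.mono hOs ?_
  have hd0 : (0 : ℝ) < (d : ℝ) - 1 := by
    have : (3 : ℝ) ≤ d := by exact_mod_cast (by omega : 3 ≤ d)
    linarith
  have hk' : (2 : ℝ) ≤ k := by exact_mod_cast hk
  have hkd' : (k : ℝ) + 1 ≤ d := by exact_mod_cast hkd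
  -- With 3/4 in the first two places, `b` in the other `d - 1` places makes the sum `k`.
  set b : ℝ := (k - 3 / 2) / (d - 1) with hb
  have hb0 : 0 < b := div_pos (by linarith) hd0
  have hb1 : b < 1 := by rw [hb, div_lt_one hd0]; linarith
  have h01 : (0 : Fin (d + 1)) ≠ 1 := by
    intro h
    have := congrArg Fin.val h
    rw [Fin.val_one', Nat.mod_eq_of_lt (by omega)] at this
    simp at this
  let l : Fin (d + 1) → ℝ := (fun _ => b) + (3 / 4 - b) • (Pi.single 0 1 + Pi.single 1 1)
  have hl : ∀ i, l i = if i = 0 ∨ i = 1 then 3 / 4 else b := by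
    intro i
    by_cases h0 : i = 0
    · subst h0; simp [l, h01]
    · by_cases h1 : i = 1
      · subst h1; simp [l, h01.symm]
      · simp [l, h0, h1]
  have hsum : ∑ i, l i = k := by
    simp only [l, Pi.add_apply, Pi.smul_apply, smul_eq_mul, Finset.sum_add_distrib,
      ← Finset.mul_sum, Finset.sum_const, Finset.card_univ, Fintype.card_fin, nsmul_eq_mul,
      Finset.sum_pi_single', Finset.mem_univ, if_true]
    have : b * (d - 1) = k - 3 / 2 := by rw [hb]; field_simp
    push_cast
    linarith
  refine ⟨∑ i, l i • intVec (w i), ?_⟩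
  rw [mem_slice, ← hsum, coords_sum]
  refine ⟨fun i => ?_, fun i => ?_, ?_⟩
  · rw [hl]; split_ifs <;> linarith
  · rw [hl]; split_ifs <;> linarith
  · rw [hl, hl]; norm_num

lemma isIntegerBody_slice_upperCube {k : ℕ} (hk : 2 ≤ k) (hkd : k + 1 ≤ d) :
    IsIntegerBody (slice hv (upperCube d) k) := by
  have hint := interior_slice_upperCube_nonempty hv hk hkd
  refine ⟨?_, hint⟩
  have hne := hint.mono interior_subset
  rw [slice_eq_image, upperCube_inter_eq_convexHull (by omega), LinearMap.image_convexHull] at hne ⊢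
  refine .of_finite ((roundedPoints_finite d k).image _) (convexHull_nonempty_iff.1 hne) ?_
  rintro _ ⟨l, hl, rfl⟩
  have : ∀ i, ∃ m : ℤ, (m : ℝ) = l i := by
    intro i
    rcases hl.1 i with h | h
    · exact ⟨0, by simp [h]⟩
    · exact ⟨1, by simp [h]⟩
  choose m hm using this
  refine isIntegerPoint_iff.2 ⟨∑ i, m i • w i, ?_⟩
  rw [intVec_sum_smul, Fintype.linearCombination_apply]
  simp only [hm]

end IntegerSimplex

/-! ### Assembly over the simplices of a triangulation. -/

section Decomposition

variable {d : ℕ}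

lemma ae_latticeCount_smul_eq_sum {J : Type*} [Fintype J] {P : Set (Fin d → ℝ)}
    {A : J → Set (Fin d → ℝ)} (hA : ∀ j, Bornology.IsBounded (A j))
    (h : ∀ᵐ u, (u ∈ P ↔ ∃ j, u ∈ A j) ∧ ∀ i j, u ∈ A i → u ∈ A j → i = j) {r : ℝ} (hr : r ≠ 0) :
    ∀ᵐ x, latticeCount (r • P) x = ∑ j, latticeCount (r • A j) x := by
  refine ae_latticeCount_eq_sum Finset.univ (fun j => r • A j) _ (fun j _ => (hA j).smul₀ r) ?_
  filter_upwards [(Measure.quasiMeasurePreserving_smul volume (inv_ne_zero hr)).ae h] with u hu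
  simpa [Set.mem_smul_set_iff_inv_smul_mem₀ hr] using hu

lemma ae_latticeCount_neg_eq_sum {J : Type*} [Fintype J] {P : Set (Fin d → ℝ)}
    {A : J → Set (Fin d → ℝ)} (hA : ∀ j, Bornology.IsBounded (A j))
    (h : ∀ᵐ u, (u ∈ P ↔ ∃ j, u ∈ A j) ∧ ∀ i j, u ∈ A i → u ∈ A j → i = j) :
    ∀ᵐ x, latticeCount (-P) x = ∑ j, latticeCount (-A j) x := by
  have e : ∀ C : Set (Fin d → ℝ), (-1 : ℝ) • C = -C := by
    intro C
    rw [Set.neg_smul_set, one_smul]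
  simpa only [e] using ae_latticeCount_smul_eq_sum hA h (neg_ne_zero.2 (one_ne_zero (α := ℝ)))

/-- An integer polytope on the line is symmetric up to an integer translation. -/
lemma IsIntegerPolytope.exists_eq_add_neg {P : Set (Fin 1 → ℝ)} (hP : IsIntegerPolytope P) :
    ∃ z : Fin 1 → ℤ, P = (fun x i => x i + (z i : ℝ)) '' (-P) := by
  obtain ⟨S, hne, hS, rfl⟩ := hP
  obtain ⟨a, ha, hmin⟩ := S.exists_min_image (fun u => u 0) hne
  obtain ⟨b, hb, hmax⟩ := S.exists_max_image (fun u => u 0) hne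
  obtain ⟨za, hza⟩ := isIntegerPoint_iff.1 (hS a ha)
  obtain ⟨zb, hzb⟩ := isIntegerPoint_iff.1 (hS b hb)
  have hmem : ∀ u : Fin 1 → ℝ, u ∈ convexHull ℝ (S : Set (Fin 1 → ℝ)) ↔ a 0 ≤ u 0 ∧ u 0 ≤ b 0 := by
    intro u
    constructor
    · intro hu
      have hc : Convex ℝ {u : Fin 1 → ℝ | a 0 ≤ u 0 ∧ u 0 ≤ b 0} := by
        have : {u : Fin 1 → ℝ | a 0 ≤ u 0 ∧ u 0 ≤ b 0} = Set.Icc a b := by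
          ext u; simp [Pi.le_def]
        rw [this]; exact convex_Icc a b
      exact convexHull_min (t := {u : Fin 1 → ℝ | a 0 ≤ u 0 ∧ u 0 ≤ b 0})
        (fun v hv => ⟨hmin v hv, hmax v hv⟩) hc hu
    · rintro ⟨h1, h2⟩
      have hab : a 0 ≤ b 0 := h1.trans h2
      have h3 : u 0 ∈ segment ℝ (a 0) (b 0) := by rw [segment_eq_Icc hab]; exact ⟨h1, h2⟩
      obtain ⟨s, t, hs, ht, hst, he⟩ := h3
      refine segment_subset_convexHull ha hb ⟨s, t, hs, ht, hst, ?_⟩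
      funext i
      rw [Subsingleton.elim i 0]
      exact he
  refine ⟨za + zb, ?_⟩
  have ha0 : a 0 = za 0 := by rw [← hza]; rfl
  have hb0 : b 0 = zb 0 := by rw [← hzb]; rfl
  ext u
  rw [hmem]
  constructor
  · rintro ⟨h1, h2⟩
    refine ⟨fun i => u i - ((za + zb) i : ℤ), ?_, by funext i; simp⟩
    rw [Set.mem_neg, hmem]
    simp only [Pi.neg_apply, Pi.add_apply, Int.cast_add]
    constructor <;> linarith
  · rintro ⟨y, hy, rfl⟩
    rw [Set.mem_neg, hmem] at hy
    simp only [Pi.neg_apply] at hy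
    simp only [Pi.add_apply, Int.cast_add]
    constructor <;> linarith [hy.1, hy.2]

/-- The set family with prescribed first member `P`, last member `-P`, and middle members `U k`. -/
def familyWithEnds (P : Set (Fin d → ℝ)) (U : ℕ → Set (Fin d → ℝ)) (k : ℕ) : Set (Fin d → ℝ) :=
  if k = 1 then P else if k = d then -P else U k

lemma familyWithEnds_symm {P : Set (Fin d → ℝ)} {U : ℕ → Set (Fin d → ℝ)}
    (hU : ∀ k, 2 ≤ k → k + 1 ≤ d → U k = -U (d + 1 - k)) (hd : 2 ≤ d) {k : ℕ}
    (hk : k ∈ Finset.Icc 1 d) :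
    familyWithEnds P U k = -familyWithEnds P U (d + 1 - k) := by
  rw [Finset.mem_Icc] at hk
  unfold familyWithEnds
  by_cases h1 : k = 1
  · rw [if_pos h1, if_neg (by omega), if_pos (by omega), neg_neg]
  · by_cases h2 : k = d
    · rw [if_neg h1, if_pos h2, if_pos (by omega)]
    · rw [if_neg h1, if_neg h2, if_neg (by omega), if_neg (by omega), hU k (by omega) (by omega)]

lemma familyWithEnds_induction {p : Set (Fin d → ℝ) → Prop} {P : Set (Fin d → ℝ)}
    {U : ℕ → Set (Fin d → ℝ)} (hP : p P) (hP' : p (-P)) (hU : ∀ k, 2 ≤ k → k + 1 ≤ d → p (U k))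
    {k : ℕ} (hk : k ∈ Finset.Icc 1 d) : p (familyWithEnds P U k) := by
  rw [Finset.mem_Icc] at hk
  unfold familyWithEnds
  split_ifs with h1 h2
  · exact hP
  · exact hP'
  · exact hU k (by omega) (by omega)

/-- The properties of the sets `Q k` that do not involve a random point. -/
structure IsEhrhartFamily (P : Set (Fin d → ℝ)) (Q : ℕ → Set (Fin d → ℝ)) : Prop where
  one : Q 1 = P
  polytopes : ∀ k ∈ Finset.Icc 1 d, IsDisjointUnionOf IsIntegerPolytope (Q k)
  bodies : (interior P).Nonempty → ∀ k ∈ Finset.Icc 1 d, IsDisjointUnionOf IsIntegerBody (Q k)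
  symm : 2 ≤ d → ∀ k ∈ Finset.Icc 1 d, Q k = -Q (d + 1 - k)
  count : ∀ n : ℕ, 1 ≤ n → ∀ᵐ x, latticeCount ((n : ℝ) • P) x =
    ∑ k ∈ Finset.Icc 1 d, (n + d - k).choose d * latticeCount (Q k) x
  sum_count : ∃ c : ℕ, ∀ᵐ x, ∑ k ∈ Finset.Icc 1 d, latticeCount (Q k) x = c

/-- A convex set with empty interior lies in its frontier, which is null. Every count vanishes
almost everywhere, and the origin serves as a symmetric filler. -/
lemma exists_isEhrhartFamily_of_interior_eq_empty (hd : 1 ≤ d) {P : Set (Fin d → ℝ)}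
    (hP : IsIntegerPolytope P) (hint : ¬(interior P).Nonempty) :
    ∃ Q : ℕ → Set (Fin d → ℝ), IsEhrhartFamily P Q := by
  have hP0 : volume P = 0 := by
    have h1 := hP.convex.addHaar_frontier volume
    refine measure_mono_null (fun u hu => ?_) h1
    rw [frontier, Set.not_nonempty_iff_eq_empty.1 hint, Set.sdiff_empty]
    exact subset_closure hu
  have hP0' : volume (-P) = 0 := by rw [Measure.measure_neg, hP0]
  have h00 : IsIntegerPolytope ({0} : Set (Fin d → ℝ)) := by
    rw [← convexHull_singleton (𝕜 := ℝ)]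
    exact .of_finite (by simp) (by simp) (by
      rintro _ rfl
      exact isIntegerPoint_iff.2 ⟨0, by funext i; simp [intVec]⟩)
  have : Nonempty (Fin d) := ⟨⟨0, hd⟩⟩
  have hz : ∀ᵐ x, ∀ k ∈ Finset.Icc 1 d, latticeCount (familyWithEnds P (fun _ => {0}) k) x = 0 := by
    rw [ae_all_iff]
    intro k
    by_cases hk : k ∈ Finset.Icc 1 d
    · have := familyWithEnds_induction (p := fun C => volume C = 0) (U := fun _ => {0}) hP0 hP0'
        (fun _ _ _ => by simp) hk
      filter_upwards [ae_latticeCount_eq_zero this] with x hx using fun _ => hx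
    · exact Filter.Eventually.of_forall fun x h => absurd h hk
  refine ⟨familyWithEnds P fun _ => {0}, ?_, ?_, ?_, ?_, ?_, 0, ?_⟩
  · simp [familyWithEnds]
  · exact fun k hk => familyWithEnds_induction (.of_self hP) (.of_self hP.neg)
      (fun _ _ _ => .of_self h00) hk
  · exact fun h => absurd h hint
  · exact fun hd k hk => familyWithEnds_symm (by simp) hd hk
  · intro n _
    have hn0 : volume ((n : ℝ) • P) = 0 := by rw [Measure.addHaar_smul, hP0, mul_zero]
    filter_upwards [ae_latticeCount_eq_zero hn0, hz] with x hx hx'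
    rw [hx, Finset.sum_eq_zero fun k hk => by rw [hx' k hk, mul_zero]]
  · filter_upwards [hz] with x hx
    exact Finset.sum_eq_zero hx

lemma exists_isEhrhartFamily_of_interior_nonempty (hd : 1 ≤ d) {P : Set (Fin d → ℝ)}
    (hP : IsIntegerPolytope P) (hint : (interior P).Nonempty) :
    ∃ Q : ℕ → Set (Fin d → ℝ), IsEhrhartFamily P Q := by
  obtain ⟨S, -, hS, hPS⟩ := id hP
  obtain ⟨J, _, v, hvi, hvS, htri⟩ := exists_ae_triangulation (V := Fin d → ℝ) volume
    (n := d) (by simp) S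
  rw [← hPS] at htri
  choose w hw using fun j i => isIntegerPoint_iff.1 (hS _ (hvS j i))
  obtain rfl : v = fun j i => intVec (w j i) := by funext j i; rw [hw]
  -- The unions must be non-empty; positive volume of `P` guarantees a simplex.
  have hJ : Nonempty J := by
    have h1 : volume P ≠ 0 :=
      ((isOpen_interior.measure_pos volume hint).trans_le (measure_mono interior_subset)).ne'
    have h2 : ∃ᵐ u, u ∈ P := by
      intro h
      exact h1 (measure_eq_zero_iff_ae_notMem.2 h)
    obtain ⟨u, hu, hu'⟩ := (h2.and_eventually htri).exists
    obtain ⟨j, -⟩ := hu'.1.1 hu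
    exact ⟨j⟩
  let H : J → ℕ → Set (Fin d → ℝ) := fun j k => slice (hvi j) (Set.Icc 0 1) k
  have hbdd : ∀ j, Bornology.IsBounded (convexHull ℝ (Set.range fun i => intVec (w j i))) := by
    intro j
    rw [convexHull_range_eq_slice_Icc (hvi j)]
    exact isBounded_slice (hvi j) subset_rfl _
  obtain ⟨U, hU⟩ := exists_symmetric_unions hd
    (fun j => Fintype.linearCombination ℝ (fun i => intVec (w j i)) '' Set.Icc 0 1)
    (fun j => isBounded_image_Icc _) (fun j k => slice (hvi j) (upperCube d) k)
    (fun j k => slice_subset_image (hvi j) (upperCube_subset d) k)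
    (fun j k hk hkd => isIntegerBody_slice_upperCube (hvi j) hk hkd)
  -- Each member of the family only needs the same counts as the hypersimplices at height `k`, not
  -- the same points.
  have hQ : ∀ k ∈ Finset.Icc 1 d,
      ∀ᵐ x, latticeCount (familyWithEnds P U k) x = ∑ j, latticeCount (H j k) x := by
    intro k hk
    rw [Finset.mem_Icc] at hk
    unfold familyWithEnds
    split_ifs with h1 h2
    · have := ae_latticeCount_smul_eq_sum hbdd htri (one_ne_zero (α := ℝ))
      simp only [one_smul] at this
      filter_upwards [this] with x hx
      rw [hx]
      refine Finset.sum_congr rfl fun j _ => ?_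
      rw [convexHull_range_eq_slice_Icc (hvi j)]
      simp [H, h1]
    · filter_upwards [ae_latticeCount_neg_eq_sum hbdd htri] with x hx
      rw [hx]
      refine Finset.sum_congr rfl fun j _ => ?_
      rw [latticeCount_neg_simplex (hvi j), h2]
    · have h3 := ae_all_iff.2 fun j =>
        ae_latticeCount_slice_eq_add (hvi j) (show 2 ≤ d by omega) hk.2
      filter_upwards [(hU k (by omega) (by omega)).2.2, h3] with x hx hx'
      rw [hx]
      exact Finset.sum_congr rfl fun j _ => (hx' j).symm
  have hQ : ∀ᵐ x, ∀ k ∈ Finset.Icc 1 d,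
      latticeCount (familyWithEnds P U k) x = ∑ j, latticeCount (H j k) x := by
    rw [ae_all_iff]
    intro k
    by_cases hk : k ∈ Finset.Icc 1 d
    · filter_upwards [hQ k hk] with x hx using fun _ => hx
    · exact Filter.Eventually.of_forall fun x h => absurd h hk
  have hPb : IsIntegerBody P := ⟨hP, hint⟩
  have hbodies : ∀ k ∈ Finset.Icc 1 d, IsDisjointUnionOf IsIntegerBody (familyWithEnds P U k) :=
    fun k hk => familyWithEnds_induction (.of_self hPb) (.of_self hPb.neg)
      (fun k hk hkd => (hU k hk hkd).1) hk
  choose c hc using fun j => exists_ae_sum_latticeCount_slice (hvi j) hd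
  refine ⟨familyWithEnds P U, ?_, ?_, ?_, ?_, ?_, ∑ j, c j, ?_⟩
  · simp [familyWithEnds]
  · exact fun k hk => (hbodies k hk).mono fun A hA => hA.1
  · exact fun _ => hbodies
  · exact fun hd k hk => familyWithEnds_symm (fun k hk hkd => (hU k hk hkd).2.1) hd hk
  · intro n hn
    have h1 := ae_latticeCount_smul_eq_sum hbdd htri
      (show (n : ℝ) ≠ 0 by exact_mod_cast (by omega : n ≠ 0))
    have h2 := ae_all_iff.2 fun j => ae_latticeCount_smul_simplex (hvi j) hd hn
    filter_upwards [h1, h2, hQ] with x hx1 hx2 hx3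
    rw [hx1, Finset.sum_congr rfl fun j _ => hx2 j, Finset.sum_comm]
    refine Finset.sum_congr rfl fun k hk => ?_
    rw [hx3 k hk, Finset.mul_sum]
  · filter_upwards [ae_all_iff.2 hc, hQ] with x hx1 hx2
    rw [Finset.sum_congr rfl hx2, Finset.sum_comm]
    exact Finset.sum_congr rfl fun j _ => hx1 j

end Decomposition

/-! ### Transfer to a uniform random point. -/

theorem mainTheorem1 (d : ℕ) (hd : 1 ≤ d) (P : Set (Fin d → ℝ)) (hP : IsIntegerPolytope P) :
    ∃ Q : ℕ → Set (Fin d → ℝ),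
      Q 1 = P ∧
      (∀ k ∈ Finset.Icc 1 d, IsDisjointUnionOf IsIntegerPolytope (Q k)) ∧
      ((interior P).Nonempty → ∀ k ∈ Finset.Icc 1 d, IsDisjointUnionOf IsIntegerBody (Q k)) ∧
      (2 ≤ d → ∀ k ∈ Finset.Icc 1 d, Q k = -Q (d + 1 - k)) ∧
      (d = 1 → ∃ z : Fin d → ℤ, Q 1 = (fun x i => x i + (z i : ℝ)) '' (-Q 1)) ∧
      ∃ c : ℕ, ∀ (Ω : Type*) [MeasurableSpace Ω] (μ : Measure Ω) [IsProbabilityMeasure μ]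
        (X : Ω → Fin d → ℝ), pdf.IsUniform X (Set.Icc 0 1) μ volume →
          (∀ n : ℕ, 1 ≤ n → ∀ᵐ ω ∂μ,
            latticeCount ((n : ℝ) • P) (X ω) =
              ∑ k ∈ Finset.Icc 1 d, (n + d - k).choose d * latticeCount (Q k) (X ω)) ∧
          (∀ᵐ ω ∂μ, ∑ k ∈ Finset.Icc 1 d, latticeCount (Q k) (X ω) = c) := by
  obtain ⟨Q, hQ⟩ : ∃ Q : ℕ → Set (Fin d → ℝ), IsEhrhartFamily P Q := by
    by_cases hint : (interior P).Nonempty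
    · exact exists_isEhrhartFamily_of_interior_nonempty hd hP hint
    · exact exists_isEhrhartFamily_of_interior_eq_empty hd hP hint
  obtain ⟨c, hc⟩ := hQ.sum_count
  refine ⟨Q, hQ.one, hQ.polytopes, hQ.bodies, hQ.symm, ?_, c, ?_⟩
  · rintro rfl
    rw [hQ.one]
    exact hP.exists_eq_add_neg
  · intro Ω _ μ _ X hX
    have hvol : volume (Set.Icc (0 : Fin d → ℝ) 1) = 1 := by
      rw [Real.volume_Icc_pi]; simp
    have hXm : AEMeasurable X μ := hX.aemeasurable (by simp [hvol]) (by simp [hvol])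
    -- Only absolute continuity of the law of `X` is used.
    have hq : ∀ {p : (Fin d → ℝ) → Prop}, (∀ᵐ x, p x) → ∀ᵐ ω ∂μ, p (X ω) := fun h =>
      ae_of_ae_map hXm (hX.absolutelyContinuous.ae_le h)
    exact ⟨fun n hn => hq (hQ.count n hn), hq hc⟩
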